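/- Let $\beta\in\{1,2\}$ and $\mathbb K=\mathbb R$ if $\beta=1$, $\mathbb K=\mathbb C$ if $\beta=2$. **Variance profile.** Let $n\ge 1$, let $(\sigma_{k,l})_{1\le k,l\le n}$ be a real symmetric matrix with non-negative coefficients, and let $\alpha_1,\dots,\alpha_n>0$ with $\sum_k\alpha_k=1$. For every $N$ let $\{1,\dots,N\}$ be partitioned into consecutive (possibly empty) intervals $I^{(N)}_1,\dots,I^{(N)}_n$ such that $|I^{(N)}_k|/N\to\alpha_k$ for every $k$, and let $\Sigma_N(i,j)=\sigma_{k,l}$ for $i\in I_k^{(N)}$, $j\in I_l^{(N)}$. Let $\sigma:[0,1]^2\to\mathbb R^+$ be equal to $\sigma_{k,l}$ on $I_k\times I_l$, where $I_k=[\alpha_1+\dots+\alpha_{k-1},\,\alpha_1+\dots+\alpha_k)$, the point $1$ being added to $I_n$. **Matrix model.** For every $N$ let $(a_{i,j})_{1\le i\le j\le N}$ (depending on $N$) be independent centered random variables, $a_{i,i}$ real and $a_{i,j}\in\mathbb K$ for $i<j$. If $\beta=1$, $\mathbb E[a_{i,j}^2]=1$ for $i<j$ and $\mathbb E[a_{i,i}^2]=2$.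 If $\beta=2$, $\mathbb E[(\Re a_{i,j})^2]=\mathbb E[(\Im a_{i,j})^2]=\frac12$ and $\mathbb E[\Re a_{i,j}\,\Im a_{i,j}]=0$ for $i<j$, and $\mathbb E[a_{i,i}^2]=1$. Assume that the law of each $a_{i,j}$ has a sharp sub-Gaussian Laplace transform: for all $u\in\mathbb K$, $$\mathbb E\big[\exp(\Re(\bar u\,a_{i,j}))\big]\le\exp\Big(\tfrac12\operatorname{Var}\big(\Re(\bar u\,a_{i,j})\big)\Big).$$ Let $X_N$ be the self-adjoint $N\times N$ matrix with $X_N(i,j)=\Sigma_N(i,j)\,a_{i,j}/\sqrt N$ for $i\le j$, and let $e$ be uniformly distributed on the unit sphere of $\mathbb K^N$, independent of $X_N$. **Theorem.** For $\theta\ge0$ put $$F(\sigma,\theta)=\sup_{\mu\in\mathcal P([0,1])}\Big\{\frac{\theta^2}{\beta}\int_{[0,1]^2}\sigma(x,y)^2\,d\mu(x)\,d\mu(y)-\frac\beta2 D(\mathrm{Leb}\,\|\,\mu)\Big\},$$ where $D$ is the Kullback–Leibler divergence. Then, with the convention $\log 0=-\infty$, $$F(\sigma,\theta)=\max_{\psi_k\ge0,\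 \sum_k\psi_k=1}\Big\{\frac{\theta^2}{\beta}\sum_{k,l=1}^n\sigma_{k,l}^2\psi_k\psi_l+\frac\beta2\sum_{k=1}^n\alpha_k(\log\psi_k-\log\alpha_k)\Big\},$$ the maximum being attained, and $$\lim_{N\to\infty}\frac1N\log\mathbb E_{X_N}\mathbb E_e\big[\exp(N\theta\langle e,X_Ne\rangle)\big]=F(\sigma,\theta).$$ Moreover, for every $\epsilon\in(0,\frac14)$, with $$V_N^\epsilon=\Big\{e:\ \|e\|=1,\ \forall k,\ \forall i\in I_k^{(N)},\ |e_i|\le\Big(\sum_{m\in I_k^{(N)}}|e_m|^2\Big)^{1/2}N^{-1/4-\epsilon}\Big\},$$ one also has $$\lim_{N\to\infty}\frac1N\log\mathbb E_e\Big[\mathbf 1_{e\in V_N^\epsilon}\,\mathbb E_{X_N}\big[\exp(N\theta\langle e,X_Ne\rangle)\big]\Big]=F(\sigma,\theta).$$ -/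

import Mathlib

open MeasureTheory ProbabilityTheory Filter Topology

namespace VarianceProfile

/-! ### Piecewise constant variance profiles -/

/-- The data of a piecewise constant variance profile: a symmetric `n × n` matrix `σ` with
non-negative coefficients, positive weights `α` of sum `1`, and for every `N` the block boundaries
`0 = bd N 0 ≤ bd N 1 ≤ ... ≤ bd N n = N` of a partition of the `N` indices into `n` consecutive
intervals whose relative lengths tend to the weights. -/
structure PiecewiseProfile (n : ℕ) where
  σ : Matrix (Fin n) (Fin n) ℝ
  σ_symm : σ.IsSymm
  σ_nonneg : ∀ k l, 0 ≤ σ k l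
  α : Fin n → ℝ
  α_pos : ∀ k, 0 < α k
  α_sum : ∑ k, α k = 1
  bd : ℕ → Fin (n + 1) → ℕ
  bd_zero : ∀ N, bd N 0 = 0
  bd_last : ∀ N, bd N (Fin.last n) = N
  bd_mono : ∀ N, Monotone (bd N)
  bd_tendsto : ∀ k : Fin n,
    Tendsto (fun N : ℕ => ((bd N k.succ : ℝ) - (bd N k.castSucc : ℝ)) / (N : ℝ)) atTop (𝓝 (α k))

namespace PiecewiseProfile

variable {n : ℕ} (S : PiecewiseProfile n)

/-- The `k`-th block of indices in `{0, ..., N - 1}`. -/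
def block (N : ℕ) (k : Fin n) : Finset (Fin N) :=
  Finset.univ.filter fun i => S.bd N k.castSucc ≤ (i : ℕ) ∧ (i : ℕ) < S.bd N k.succ

/-- The `N × N` matrix `Σ_N`, equal to `σ k l` on the product of the blocks `k` and `l`. -/
def profileMatrix (N : ℕ) : Matrix (Fin N) (Fin N) ℝ :=
  fun i j => ∑ k, ∑ l, if i ∈ S.block N k ∧ j ∈ S.block N l then S.σ k l else 0

/-- The `k`-th interval `[α_1 + ... + α_{k-1}, α_1 + ... + α_k)` of `[0,1]`; the last one also
contains the point `1`. -/
def interval (k : Fin n) : Set unitInterval :=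
  {x | ∑ i ∈ Finset.Iio k, S.α i ≤ (x : ℝ) ∧
    ((x : ℝ) < ∑ i ∈ Finset.Iic k, S.α i ∨ ((k : ℕ) + 1 = n ∧ (x : ℝ) = 1))}

open Classical in
/-- The variance profile `σ : [0,1]² → ℝ⁺`, equal to `σ k l` on the product of the intervals
`k` and `l`. -/
noncomputable def profile (x y : unitInterval) : ℝ :=
  ∑ k, ∑ l, if x ∈ S.interval k ∧ y ∈ S.interval l then S.σ k l else 0

/-- The functional `(θ² / β) ∑ σ_{kl}² ψ_k ψ_l + (β / 2) ∑ α_k (log ψ_k - log α_k)`, with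
`log 0 = -∞`. -/
noncomputable def vecPsi (β θ : ℝ) (ψ : Fin n → ℝ) : EReal :=
  ((θ ^ 2 / β * ∑ k, ∑ l, S.σ k l ^ 2 * ψ k * ψ l : ℝ) : EReal) +
    ((β / 2 : ℝ) : EReal) * ∑ k, ((S.α k : ℝ) : EReal) *
      (ENNReal.log (ENNReal.ofReal (ψ k)) - ((Real.log (S.α k) : ℝ) : EReal))

end PiecewiseProfile

/-- `F(σ, θ)`: the supremum over the probability measures `μ` on `[0,1]` of
`(θ² / β) ∫∫ σ(x,y)² dμ(x) dμ(y) - (β / 2) D(Leb ‖ μ)`, with `D` the Kullback-Leibler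
divergence. -/
noncomputable def limitF (β θ : ℝ) (σ : unitInterval → unitInterval → ℝ) : EReal :=
  ⨆ μ : ProbabilityMeasure unitInterval,
    ((θ ^ 2 / β * ∫ x, ∫ y, σ x y ^ 2 ∂(μ : Measure unitInterval)
        ∂(μ : Measure unitInterval) : ℝ) : EReal) -
      ((β / 2 : ℝ) : EReal) *
        ((InformationTheory.klDiv (volume : Measure unitInterval)
          (μ : Measure unitInterval) : ENNReal) : EReal)

section Model

variable (𝕜 : Type*) [RCLike 𝕜]

/-- The parameter `β`: `1` when `𝕜 = ℝ` and `2` when `𝕜 = ℂ`. -/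
noncomputable def dysonIndex : ℝ := (Module.finrank ℝ 𝕜 : ℝ)

variable {𝕜}

/-- A measure on `𝕜` (`ℝ` or `ℂ ≅ ℝ²`) has a sharp sub-Gaussian Laplace transform:
`∫ exp ⟨u, x⟩ dμ(x) ≤ exp (⟨u, C u⟩ / 2)` for all `u`. Here `⟨u, x⟩ = Re (ū x)` and `C` is the
covariance matrix of `μ`, so that `⟨u, C u⟩` is the variance of `⟨u, x⟩` under `μ`. -/
def SharpSubGaussian (μ : Measure 𝕜) : Prop :=
  ∀ u : 𝕜, ∫⁻ x, ENNReal.ofReal (Real.exp (RCLike.re (starRingEnd 𝕜 u * x))) ∂μ ≤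
    ENNReal.ofReal (Real.exp (Var[fun x : 𝕜 => RCLike.re (starRingEnd 𝕜 u * x); μ] / 2))

/-- The family `(a i j)`, `i ≤ j`, consists of the unnormalized entries of a Wigner matrix:
independent, centered, real on the diagonal. If `𝕜 = ℝ`, the variances are `1` off the diagonal and
`2` on it. If `𝕜 = ℂ`, the off-diagonal entries satisfy `E (Re a)² = E (Im a)² = 1 / 2` and
`E (Re a) (Im a) = 0`, and the diagonal ones have variance `1`. The variables `a i j` with `j < i`
play no role. -/
structure IsWignerFamily {Ω : Type*} [MeasurableSpace Ω] (P : Measure Ω) {N : ℕ}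
    (a : Fin N → Fin N → Ω → 𝕜) : Prop where
  measurable : ∀ i j, i ≤ j → Measurable (a i j)
  indep : iIndepFun (fun (p : {p : Fin N × Fin N // p.1 ≤ p.2}) => a p.1.1 p.1.2) P
  centered : ∀ i j, i ≤ j → ∫ ω, a i j ω ∂P = 0
  diag_real : ∀ i, ∀ᵐ ω ∂P, RCLike.im (a i i ω) = 0
  diag_var : ∀ i, ∫ ω, RCLike.re (a i i ω) ^ 2 ∂P = 2 / dysonIndex 𝕜
  offdiag_re : ∀ i j, i < j → ∫ ω, RCLike.re (a i j ω) ^ 2 ∂P = 1 / dysonIndex 𝕜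
  offdiag_im : ∀ i j, i < j → ∫ ω, RCLike.im (a i j ω) ^ 2 ∂P = 1 - 1 / dysonIndex 𝕜
  offdiag_re_im : ∀ i j, i < j → ∫ ω, RCLike.re (a i j ω) * RCLike.im (a i j ω) ∂P = 0

/-- The Wigner matrix `W` with entries `a i j / √N` for `i ≤ j`, completed into a Hermitian
matrix. -/
noncomputable def wignerMatrix {N : ℕ} (a : Fin N → Fin N → 𝕜) : Matrix (Fin N) (Fin N) 𝕜 :=
  fun i j => (if i ≤ j then a i j else starRingEnd 𝕜 (a j i)) / ((Real.sqrt N : ℝ) : 𝕜)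

/-- The matrix `X = W ⊙ A` (entrywise product) for a real matrix `A`. -/
noncomputable def modelMatrix {N : ℕ} (A : Matrix (Fin N) (Fin N) ℝ) (a : Fin N → Fin N → 𝕜) :
    Matrix (Fin N) (Fin N) 𝕜 :=
  Matrix.hadamard (wignerMatrix a) (A.map fun x => (x : 𝕜))

variable (𝕜) in
/-- The unit sphere of `𝕜^N` for the Euclidean norm. -/
abbrev USphere (N : ℕ) : Type _ := Metric.sphere (0 : EuclideanSpace 𝕜 (Fin N)) 1

variable (𝕜) in
/-- The uniform probability measure on the unit sphere of `𝕜^N`: the normalized surface measure. -/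
noncomputable def uniformSphere (N : ℕ) : Measure (USphere 𝕜 N) :=
  ((Measure.addHaar : Measure (EuclideanSpace 𝕜 (Fin N))).toSphere Set.univ)⁻¹ •
    (Measure.addHaar : Measure (EuclideanSpace 𝕜 (Fin N))).toSphere

/-- The (real) number `⟨e, X e⟩` for a Hermitian matrix `X`. -/
noncomputable def quadForm {N : ℕ} (X : Matrix (Fin N) (Fin N) 𝕜) (e : USphere 𝕜 N) : ℝ :=
  RCLike.re (∑ i, ∑ j, starRingEnd 𝕜 (e.1 i) * X i j * e.1 j)

/-- The set of delocalized unit vectors: `|e_i| ≤ √ψ_k N^(-1/4-ε)` for all `k` and all `i` in the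
block `k`, where `ψ_k` is the sum of the `|e_m|²` over the block `k`. -/
def deloc {n : ℕ} (S : PiecewiseProfile n) (ε : ℝ) (N : ℕ) : Set (USphere 𝕜 N) :=
  {e | ∀ k, ∀ i ∈ S.block N k,
    ‖e.1 i‖ ≤ Real.sqrt (∑ m ∈ S.block N k, ‖e.1 m‖ ^ 2) * (N : ℝ) ^ (-(1 / 4 : ℝ) - ε)}

/-- `F_N(θ, β) = (1 / N) log E_X E_e exp (N θ ⟨e, X_N e⟩)`. -/
noncomputable def annealedF {n : ℕ} (S : PiecewiseProfile n) {Ω : Type*} [MeasurableSpace Ω]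
    (P : Measure Ω) {N : ℕ} (a : Fin N → Fin N → Ω → 𝕜) (θ : ℝ) : EReal :=
  (((N : ℝ)⁻¹ : ℝ) : EReal) * ENNReal.log
    (∫⁻ ω, ∫⁻ e, ENNReal.ofReal (Real.exp (N * θ *
      quadForm (modelMatrix (S.profileMatrix N) fun i j => a i j ω) e)) ∂(uniformSphere 𝕜 N) ∂P)

/-- `(1 / N) log E_e [1_{e ∈ V} E_X exp (N θ ⟨e, X_N e⟩)]` with `V` the set of delocalized
vectors. -/
noncomputable def annealedFDeloc {n : ℕ} (S : PiecewiseProfile n) {Ω : Type*} [MeasurableSpace Ω]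
    (P : Measure Ω) {N : ℕ} (a : Fin N → Fin N → Ω → 𝕜) (θ ε : ℝ) : EReal :=
  (((N : ℝ)⁻¹ : ℝ) : EReal) * ENNReal.log
    (∫⁻ e in deloc S ε N, ∫⁻ ω, ENNReal.ofReal (Real.exp (N * θ *
      quadForm (modelMatrix (S.profileMatrix N) fun i j => a i j ω) e)) ∂P ∂(uniformSphere 𝕜 N))

end Model

end VarianceProfile

/-! Averaging over the matrix first reduces everything to the masses of `e` in the blocks. For fixed
`e` the exponent is a sum over `i ≤ j` of independent terms `Re (conj u * a i j)`, with `u` of order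
`θ √N |e_i| |e_j|`. The sharp sub-Gaussian bound therefore gives at most `exp (N θ²/β ∑ Σ_N(i,j)²
|e_i|² |e_j|²)`, and the double sum depends only on the block masses `ψ_k` (`lintegral_exponent_le`,
`sum_profileMatrix_eq`). If `|e_i| ≤ N^(-1/4-ε)`, then `u` is of order `N^(-2ε)`; the Laplace
transforms are then governed by the variances, and the same bound holds from below up to a factor `1
- δ` in the exponent (`le_lintegral_exponent`).

What remains is a large deviation estimate for the vector of block masses of a uniform point of the
sphere: at speed `N`, its density at `ψ` is `exp (N β/2 ∑ α_k (log ψ_k - log α_k))`. No Gamma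
function is needed. The uniform measure of a set is the relative volume of the cone over it, and
cones are compared with products of balls in the blocks. A product of balls scales explicitly, and
the ratio between the product of the unit balls and the full ball (`volRatio`) is estimated by
placing one product inside the ball (`volRatio_le`) and by covering the ball with a fixed finite
grid of products (`le_volRatio`), where Gibbs' inequality bounds every piece. The upper bound of the
theorem uses the same grid (`eventually_lintegral_energy_le`).

For the lower bound, balls are replaced by flat shells, whose points have no large coordinate. For
`ε < 1/4` a shell fills at least half of its ball in each block (`eventually_flatShell`), so
delocalization costs nothing at exponential scale (`eventually_le_annealed_deloc`).

The variational formula is a data processing inequality for the relative entropy: given the masses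
of the intervals, the least divergence is attained by a density that is constant on each interval
(`le_klDiv`, `exists_measure`, `limitF_eq`). -/

namespace VarianceProfile

/-! ### Volumes of balls and of products of balls. -/

section Geometry

variable (𝕜 : Type*) [RCLike 𝕜]

/-- The product measure of Haar measures on `ι → 𝕜`. -/
noncomputable def haarPi (ι : Type*) [Fintype ι] : Measure (ι → 𝕜) :=
  Measure.pi fun _ => (Measure.addHaar : Measure 𝕜)

instance haarPi_isAddHaarMeasure (ι : Type*) [Fintype ι] : (haarPi 𝕜 ι).IsAddHaarMeasure := by
  unfold haarPi; infer_instance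

/-- The square of the Euclidean norm of a vector. -/
noncomputable def sqSum {𝕜 : Type*} [RCLike 𝕜] {ι : Type*} [Fintype ι] (x : ι → 𝕜) : ℝ :=
  ∑ i, ‖x i‖ ^ 2

/-- The volume of the Euclidean unit ball of `ι → 𝕜`. -/
noncomputable def ballVol (ι : Type*) [Fintype ι] : ℝ :=
  (haarPi 𝕜 ι).real {x | sqSum x ≤ 1}

variable {𝕜} {ι κ : Type*} [Fintype ι] [Fintype κ]

lemma sqSum_nonneg (x : ι → 𝕜) : 0 ≤ sqSum x :=
  Finset.sum_nonneg fun _ _ => sq_nonneg _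

lemma continuous_sqSum : Continuous (sqSum : (ι → 𝕜) → ℝ) := by
  unfold sqSum; fun_prop

lemma norm_sq_le_sqSum (x : ι → 𝕜) (i : ι) : ‖x i‖ ^ 2 ≤ sqSum x :=
  Finset.single_le_sum (f := fun i => ‖x i‖ ^ 2) (fun _ _ => sq_nonneg _) (Finset.mem_univ i)

lemma sqSum_smul (c : ℝ) (x : ι → 𝕜) : sqSum (c • x) = c ^ 2 * sqSum x := by
  simp [sqSum, norm_smul, mul_pow, Finset.mul_sum]

lemma sqSum_eq_sum_fiber [DecidableEq κ] (b : ι → κ) (x : ι → 𝕜) :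
    sqSum x = ∑ k, sqSum fun i : {i // b i = k} => x i := by
  unfold sqSum
  rw [← Finset.sum_fiberwise_of_maps_to (g := b) (t := Finset.univ) (fun _ _ => Finset.mem_univ _)]
  refine Finset.sum_congr rfl fun k _ => ?_
  rw [Finset.sum_subtype (p := fun i => b i = k)]
  simp

lemma dysonIndex_pos : 0 < dysonIndex 𝕜 := by
  unfold dysonIndex
  exact_mod_cast Module.finrank_pos

lemma haarPi_sqSum_le_lt_top (t : ℝ) : haarPi 𝕜 ι {x | sqSum x ≤ t} < ⊤ := by
  apply Bornology.IsBounded.measure_lt_top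
  refine (Metric.isBounded_closedBall (x := (0 : ι → 𝕜)) (r := √t)).subset fun x hx => ?_
  rw [mem_closedBall_zero_iff, pi_norm_le_iff_of_nonneg (Real.sqrt_nonneg _)]
  intro i
  apply Real.le_sqrt_of_sq_le
  exact (norm_sq_le_sqSum x i).trans hx

lemma ballVol_pos : 0 < ballVol 𝕜 ι := by
  unfold ballVol
  refine ENNReal.toReal_pos ?_ (haarPi_sqSum_le_lt_top 1).ne
  refine (lt_of_lt_of_le (IsOpen.measure_pos (haarPi 𝕜 ι)
    (U := {x : ι → 𝕜 | sqSum x < 1}) (isOpen_lt continuous_sqSum continuous_const) ⟨0, ?_⟩)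
    (measure_mono ?_)).ne'
  · simp [sqSum]
  · intro x hx
    exact (show sqSum x < 1 from hx).le

lemma finrank_pi_eq : (Module.finrank ℝ (ι → 𝕜) : ℝ) = dysonIndex 𝕜 * Fintype.card ι := by
  rw [Module.finrank_pi_fintype]
  simp [dysonIndex, mul_comm]

-- The parameter `t` is a squared radius and the real dimension is `β * card ι`, hence the exponent.
-- An empty `ι`, which an empty block produces, is allowed.
open scoped Pointwise in
lemma haarPi_real_scale {t : ℝ} (ht : 0 < t) (A : Set (ι → 𝕜)) :
    (haarPi 𝕜 ι).real {x | (√t)⁻¹ • x ∈ A} =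
      t ^ (dysonIndex 𝕜 * Fintype.card ι / 2) * (haarPi 𝕜 ι).real A := by
  have hs : 0 < √t := Real.sqrt_pos.2 ht
  have : {x : ι → 𝕜 | (√t)⁻¹ • x ∈ A} = √t • A := by
    ext x
    rw [Set.mem_smul_set_iff_inv_smul_mem₀ hs.ne']; rfl
  rw [this, Measure.real, Measure.addHaar_smul, ENNReal.toReal_mul, Measure.real,
    ENNReal.toReal_ofReal (abs_nonneg _), abs_of_nonneg (by positivity)]
  congr 1
  rw [← Real.rpow_natCast, finrank_pi_eq, Real.sqrt_eq_rpow, ← Real.rpow_mul ht.le]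
  congr 1; ring

lemma haarPi_real_sqSum_le {t : ℝ} (ht : 0 < t) :
    (haarPi 𝕜 ι).real {x | sqSum x ≤ t} =
      t ^ (dysonIndex 𝕜 * Fintype.card ι / 2) * ballVol 𝕜 ι := by
  rw [ballVol, ← haarPi_real_scale ht]
  congr 1
  ext x
  simp only [Set.mem_ofPred_eq, sqSum_smul, inv_pow, Real.sq_sqrt ht.le]
  rw [inv_mul_le_iff₀ ht, mul_one]

lemma measurePreserving_piCurry_symm [DecidableEq κ] (F : κ → Type*) [∀ k, Fintype (F k)]
    {X : Type*} [MeasurableSpace X] (μ : Measure X) [SigmaFinite μ] :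
    MeasurePreserving (MeasurableEquiv.piCurry (fun (k : κ) (_ : F k) => X)).symm
      (Measure.pi fun k => Measure.pi fun _ : F k => μ) (Measure.pi fun _ : Sigma F => μ) := by
  refine ⟨MeasurableEquiv.measurable _, ?_⟩
  refine (Measure.pi_eq fun s hs => ?_).symm
  rw [MeasurableEquiv.map_apply]
  have : (MeasurableEquiv.piCurry (fun (k : κ) (_ : F k) => X)).symm ⁻¹' (Set.univ.pi s) =
      Set.univ.pi fun k => Set.univ.pi fun i => s ⟨k, i⟩ := by
    ext x
    simp [Set.mem_pi, MeasurableEquiv.coe_piCurry_symm, Sigma.uncurry, Sigma.forall]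
  rw [this, Measure.pi_pi]
  simp_rw [Measure.pi_pi]
  rw [← Finset.univ_sigma_univ, Finset.prod_sigma]

/-- Fubini for the splitting of the coordinates along the fibres of `b`. The sets `A k` need not be
measurable: the transport goes through measurable equivalences, and the measure of a box in a
product holds for arbitrary sides. -/
lemma haarPi_blocks [DecidableEq κ] (b : ι → κ) (A : ∀ k, Set ({i // b i = k} → 𝕜)) :
    haarPi 𝕜 ι {x | ∀ k, (fun i : {i // b i = k} => x i) ∈ A k} =
      ∏ k, haarPi 𝕜 {i // b i = k} (A k) := by
  have h1 := measurePreserving_piCongrLeft (fun _ : ι => (Measure.addHaar : Measure 𝕜))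
    (Equiv.sigmaFiberEquiv b)
  have h2 := measurePreserving_piCurry_symm (fun k => {i // b i = k})
    (Measure.addHaar : Measure 𝕜)
  have h := h1.comp h2
  rw [haarPi, ← h.map_eq]
  rw [← MeasurableEquiv.coe_trans, MeasurableEquiv.map_apply]
  have : ((MeasurableEquiv.piCurry fun k (_ : {i // b i = k}) ↦ 𝕜).symm.trans
      (MeasurableEquiv.piCongrLeft (fun _ : ι => 𝕜) (Equiv.sigmaFiberEquiv b))) ⁻¹'
      {x | ∀ k, (fun i : {i // b i = k} => x i) ∈ A k} = Set.univ.pi A := by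
    ext x
    simp only [Set.mem_preimage, Set.mem_ofPred_eq, Set.mem_pi, Set.mem_univ, true_imp_iff]
    refine forall_congr' fun k => ?_
    have : (fun i : {i // b i = k} => ((MeasurableEquiv.piCurry fun k (_ : {i // b i = k}) ↦
      𝕜).symm.trans (MeasurableEquiv.piCongrLeft (fun _ : ι => 𝕜) (Equiv.sigmaFiberEquiv b))) x i)
        = x k := by
      ext i
      have := MeasurableEquiv.piCongrLeft_apply_apply (Equiv.sigmaFiberEquiv b)
        (β := fun _ => 𝕜) ((MeasurableEquiv.piCurry fun k (_ : {i // b i = k}) ↦ 𝕜).symm x) ⟨k, i⟩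
      simpa [Sigma.uncurry] using this
    rw [this]
  rw [this, Measure.pi_pi]
  rfl

lemma haarPi_real_blocks [DecidableEq κ] (b : ι → κ) (A : ∀ k, Set ({i // b i = k} → 𝕜)) :
    (haarPi 𝕜 ι).real {x | ∀ k, (fun i : {i // b i = k} => x i) ∈ A k} =
      ∏ k, (haarPi 𝕜 {i // b i = k}).real (A k) := by
  simp only [Measure.real, haarPi_blocks, ENNReal.toReal_prod]

lemma haarPi_real_blocks_sqSum_le [DecidableEq κ] (b : ι → κ) {t : κ → ℝ} (ht : ∀ k, 0 < t k) :
    (haarPi 𝕜 ι).real {x | ∀ k, sqSum (fun i : {i // b i = k} => x i) ≤ t k} =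
      ∏ k, (t k ^ (dysonIndex 𝕜 * Fintype.card {i // b i = k} / 2) *
        ballVol 𝕜 {i // b i = k}) := by
  rw [← Finset.prod_congr rfl fun k _ => haarPi_real_sqSum_le (ht k), ← haarPi_real_blocks]
  rfl

/-- A product of balls is contained in a ball. -/
lemma prod_ballVol_le [DecidableEq κ] (b : ι → κ) {t : κ → ℝ} (ht : ∀ k, 0 < t k)
    (hsum : ∑ k, t k ≤ 1) :
    ∏ k, (t k ^ (dysonIndex 𝕜 * Fintype.card {i // b i = k} / 2) *
      ballVol 𝕜 {i // b i = k}) ≤ ballVol 𝕜 ι := by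
  rw [← haarPi_real_blocks_sqSum_le b ht]
  refine measureReal_mono (fun x hx => ?_) (haarPi_sqSum_le_lt_top 1).ne
  rw [Set.mem_ofPred_eq, sqSum_eq_sum_fiber b]
  exact (Finset.sum_le_sum fun k _ => hx k).trans hsum

/-- The grid of the multi-indices that are relevant for the covering of a simplex. -/
def simplexGrid (κ : Type*) [Fintype κ] [DecidableEq κ] (M : ℕ) : Finset (κ → Fin (M + 1)) :=
  Finset.univ.filter fun j => ∑ k, (j k : ℕ) ≤ M

/-- Rounding `M * s k` down gives the multi-index. Each coordinate is overestimated by at most `1 /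
M`, so the total of the upper bounds stays below `1 + card κ / M`. -/
lemma exists_simplexGrid [DecidableEq κ] {M : ℕ} (hM : 0 < M) {s : κ → ℝ} (hs : ∀ k, 0 ≤ s k)
    (hsum : ∑ k, s k ≤ 1) : ∃ j ∈ simplexGrid κ M, ∀ k, s k ≤ ((j k : ℕ) + 1 : ℝ) / M := by
  have hM' : (0 : ℝ) < M := by exact_mod_cast hM
  have h1 : ∀ k, ((⌊s k * M⌋₊ : ℕ) : ℝ) ≤ s k * M := fun k =>
    Nat.floor_le (mul_nonneg (hs k) hM'.le)
  have h2 : ∀ k, s k ≤ 1 := fun k =>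
    (Finset.single_le_sum (fun k _ => hs k) (Finset.mem_univ k)).trans hsum
  have h3 : ∀ k, ⌊s k * M⌋₊ ≤ M := fun k => by
    have := (h1 k).trans (mul_le_mul_of_nonneg_right (h2 k) hM'.le)
    rw [one_mul] at this
    exact_mod_cast this
  refine ⟨fun k => ⟨⌊s k * M⌋₊, Nat.lt_succ_of_le (h3 k)⟩, ?_, fun k => ?_⟩
  · simp only [simplexGrid, Finset.mem_filter, Finset.mem_univ, true_and]
    have : ((∑ k, ⌊s k * M⌋₊ : ℕ) : ℝ) ≤ M := by
      push_cast
      calc ∑ k, (⌊s k * M⌋₊ : ℝ) ≤ ∑ k, s k * M := Finset.sum_le_sum fun k _ => h1 k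
        _ = (∑ k, s k) * M := by rw [Finset.sum_mul]
        _ ≤ 1 * M := by gcongr
        _ = M := one_mul _
    exact_mod_cast this
  · rw [le_div_iff₀ hM']
    exact (Nat.lt_floor_add_one _).le

/-- A ball is covered by a grid of products of balls. -/
lemma ballVol_le_sum [DecidableEq κ] (b : ι → κ) {M : ℕ} (hM : 0 < M) :
    ballVol 𝕜 ι ≤ ∑ j ∈ simplexGrid κ M, ∏ k,
      ((((j k : ℕ) + 1 : ℝ) / M) ^ (dysonIndex 𝕜 * Fintype.card {i // b i = k} / 2) *
        ballVol 𝕜 {i // b i = k}) := by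
  have hM' : (0 : ℝ) < M := by exact_mod_cast hM
  have hpos : ∀ (j : κ → Fin (M + 1)) (k : κ), 0 < ((j k : ℕ) + 1 : ℝ) / M := fun j k => by
    positivity
  rw [← Finset.sum_congr rfl fun j _ => haarPi_real_blocks_sqSum_le b (hpos j)]
  refine le_trans (measureReal_mono ?_ ?_) (measureReal_biUnion_finset_le _ _)
  · intro x hx
    rw [Set.mem_ofPred_eq, sqSum_eq_sum_fiber b] at hx
    obtain ⟨j, hj, h⟩ := exists_simplexGrid hM (fun k => sqSum_nonneg _) hx
    simp only [Set.mem_iUnion]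
    exact ⟨j, hj, h⟩
  · refine (measure_biUnion_lt_top (Finset.finite_toSet _) fun j _ => ?_).ne
    refine (measure_mono ?_).trans_lt
      (haarPi_sqSum_le_lt_top (𝕜 := 𝕜) (ι := ι) (∑ k, ((j k : ℕ) + 1 : ℝ) / M))
    intro x hx
    rw [Set.mem_ofPred_eq, sqSum_eq_sum_fiber b]
    exact Finset.sum_le_sum fun k _ => hx k

end Geometry

/-! ### Most of the volume of a ball lies near its boundary and has no large coordinate. -/

section Delocalization

variable {𝕜 : Type*} [RCLike 𝕜] {ι : Type*} [Fintype ι]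

/-- A proportion of the ball that is exponentially close to one has a small given coordinate. -/
lemma haarPi_real_large_coord_le (i₀ : ι) {s : ℝ} (hs : 0 < s) (hs1 : s < 1) :
    (haarPi 𝕜 ι).real {x | sqSum x ≤ 1 ∧ s < ‖x i₀‖ ^ 2} ≤
      Real.exp (-(dysonIndex 𝕜 * s * (Fintype.card ι - 1) / 4)) * (2 / s) ^ (dysonIndex 𝕜 / 2) *
        ballVol 𝕜 ι := by
  classical
  -- The coordinate `i₀` and the others form two blocks. The event lies in a product of two balls,
  -- and a slightly different product lies in the unit ball; comparing the two products makes
  -- explicit volumes unnecessary.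
  set b : ι → Bool := fun i => decide (i = i₀) with hb
  have hβ : 0 < dysonIndex 𝕜 := dysonIndex_pos
  have hct : Fintype.card {i // b i = true} = 1 := by simp [hb]
  have hcf : (Fintype.card {i // b i = false} : ℝ) = Fintype.card ι - 1 := by
    have : Fintype.card {i // b i = false} = Fintype.card ι - 1 := by
      simp [hb, Fintype.card_subtype_compl]
    rw [this, Nat.cast_sub (Fintype.card_pos_iff.2 ⟨i₀⟩), Nat.cast_one]
  set Vt := ballVol 𝕜 {i // b i = true}
  set Vf := ballVol 𝕜 {i // b i = false}
  have hVt : 0 < Vt := ballVol_pos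
  have hVf : 0 < Vf := ballVol_pos
  set p : ℝ := dysonIndex 𝕜 * (Fintype.card ι - 1) / 2 with hp
  have hp0 : 0 ≤ p := by
    rw [hp, ← hcf]; positivity
  have h1 : (haarPi 𝕜 ι).real {x | sqSum x ≤ 1 ∧ s < ‖x i₀‖ ^ 2} ≤ Vt * ((1 - s) ^ p * Vf) := by
    have := haarPi_real_blocks_sqSum_le (𝕜 := 𝕜) b (t := fun c => if c then 1 else 1 - s)
      (by intro k; cases k <;> simp [hs1])
    rw [Fintype.prod_bool, hct, hcf] at this
    simp only [Real.one_rpow, one_mul, if_true, Bool.false_eq_true, if_false] at this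
    rw [← this]
    refine measureReal_mono ?_ ?_
    · rintro x ⟨hx, hx'⟩
      rw [sqSum_eq_sum_fiber b, Fintype.sum_bool] at hx
      have h0 : ‖x i₀‖ ^ 2 ≤ sqSum fun i : {i // b i = true} => x i :=
        norm_sq_le_sqSum (fun i : {i // b i = true} => x i) ⟨i₀, by simp [hb]⟩
      have h00 := sqSum_nonneg fun i : {i // b i = false} => x i
      intro k
      cases k
      · simp only [Bool.false_eq_true, if_false]; linarith
      · simp only [if_true]; linarith
    · refine ((measure_mono ?_).trans_lt
        (haarPi_sqSum_le_lt_top (𝕜 := 𝕜) (ι := ι) (1 + (1 - s)))).ne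
      intro x hx
      rw [Set.mem_ofPred_eq, sqSum_eq_sum_fiber b, Fintype.sum_bool]
      have ht := hx true
      have hf := hx false
      simp only [Bool.false_eq_true, if_false, if_true] at ht hf
      exact add_le_add ht hf
  have h2 : (s / 2) ^ (dysonIndex 𝕜 / 2) * Vt * ((1 - s / 2) ^ p * Vf) ≤ ballVol 𝕜 ι := by
    have := prod_ballVol_le (𝕜 := 𝕜) b (t := fun c => if c then s / 2 else 1 - s / 2)
      (by intro k; cases k <;> simp <;> linarith) (by simp)
    rw [Fintype.prod_bool, hct, hcf] at this
    simpa using this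
  -- Since `1 - s ≤ (1 - s / 2)²`, passing from squared radius `1 - s` to `1 - s / 2` gains a factor
  -- `(1 - s / 2) ^ p`, which is exponentially small.
  have h3 : (1 - s) ^ p ≤ Real.exp (-(s / 2) * p) * (1 - s / 2) ^ p := by
    rw [Real.exp_mul, ← Real.mul_rpow (Real.exp_pos _).le (by linarith)]
    refine Real.rpow_le_rpow (by linarith) ?_ hp0
    have h4 : 1 - s / 2 ≤ Real.exp (-(s / 2)) := by
      have := Real.add_one_le_exp (-(s / 2)); linarith
    calc 1 - s ≤ (1 - s / 2) * (1 - s / 2) := by nlinarith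
      _ ≤ _ := mul_le_mul_of_nonneg_right h4 (by linarith)
  have h5 : (2 / s) ^ (dysonIndex 𝕜 / 2) * (s / 2) ^ (dysonIndex 𝕜 / 2) = 1 := by
    rw [← Real.mul_rpow (by positivity) (by positivity), div_mul_div_comm, mul_comm,
      div_self (by positivity), Real.one_rpow]
  calc (haarPi 𝕜 ι).real {x | sqSum x ≤ 1 ∧ s < ‖x i₀‖ ^ 2} ≤ Vt * ((1 - s) ^ p * Vf) := h1
    _ ≤ Vt * ((Real.exp (-(s / 2) * p) * (1 - s / 2) ^ p) * Vf) := by gcongr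
    _ = Real.exp (-(s / 2) * p) * ((2 / s) ^ (dysonIndex 𝕜 / 2) * (s / 2) ^ (dysonIndex 𝕜 / 2)) *
        (Vt * ((1 - s / 2) ^ p * Vf)) := by rw [h5]; ring
    _ = Real.exp (-(s / 2) * p) * (2 / s) ^ (dysonIndex 𝕜 / 2) *
        ((s / 2) ^ (dysonIndex 𝕜 / 2) * Vt * ((1 - s / 2) ^ p * Vf)) := by ring
    _ ≤ Real.exp (-(s / 2) * p) * (2 / s) ^ (dysonIndex 𝕜 / 2) * ballVol 𝕜 ι := by gcongr
    _ = _ := by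
      congr 3
      rw [hp]; ring

/-- The vectors of squared norm between `(1 - δ) t` and `t` whose squared coordinates are at most
`s t`. -/
def flatShell (𝕜 : Type*) [RCLike 𝕜] (ι : Type*) [Fintype ι] (δ s t : ℝ) : Set (ι → 𝕜) :=
  {x | (1 - δ) * t ≤ sqSum x ∧ sqSum x ≤ t ∧ ∀ i, ‖x i‖ ^ 2 ≤ s * t}

/-- Union bound: the unit ball minus the shell is covered by the ball of squared radius `1 - δ` and
by one set of points with a large coordinate for each index. -/
lemma flatShell_one_volume {δ s : ℝ} (hδ : δ < 1) (hs : 0 < s) (hs1 : s < 1) :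
    (1 - (1 - δ) ^ (dysonIndex 𝕜 * Fintype.card ι / 2) - Fintype.card ι *
      (Real.exp (-(dysonIndex 𝕜 * s * (Fintype.card ι - 1) / 4)) * (2 / s) ^ (dysonIndex 𝕜 / 2))) *
        ballVol 𝕜 ι ≤ (haarPi 𝕜 ι).real (flatShell 𝕜 ι δ s 1) := by
  have hfin : ∀ A : Set (ι → 𝕜), A ⊆ {x | sqSum x ≤ 1} → haarPi 𝕜 ι A ≠ ⊤ := fun A hA =>
    ((measure_mono hA).trans_lt (haarPi_sqSum_le_lt_top 1)).ne
  set E : ι → Set (ι → 𝕜) := fun i => {x | sqSum x ≤ 1 ∧ s < ‖x i‖ ^ 2} with hE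
  set D : Set (ι → 𝕜) := {x | sqSum x ≤ 1 - δ}
  have hcover : {x : ι → 𝕜 | sqSum x ≤ 1} ⊆
      flatShell 𝕜 ι δ s 1 ∪ ((D ∩ {x | sqSum x ≤ 1}) ∪ ⋃ i ∈ Finset.univ, E i) := by
    intro x hx
    by_cases h1 : sqSum x ≤ 1 - δ
    · exact Or.inr (Or.inl ⟨h1, hx⟩)
    by_cases h2 : ∀ i, ‖x i‖ ^ 2 ≤ s
    · left
      refine ⟨by rw [mul_one]; exact (not_le.1 h1).le, hx, by simpa using h2⟩
    · push Not at h2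
      obtain ⟨i, hi⟩ := h2
      right; right
      simp only [Set.mem_iUnion]
      exact ⟨i, Finset.mem_univ i, hx, hi⟩
  have hEsub : (⋃ i ∈ Finset.univ, E i) ⊆ {x : ι → 𝕜 | sqSum x ≤ 1} := by
    intro x hx
    simp only [Set.mem_iUnion] at hx
    obtain ⟨i, -, hi⟩ := hx
    exact hi.1
  have hS : flatShell 𝕜 ι δ s 1 ⊆ {x | sqSum x ≤ 1} := fun x hx => hx.2.1
  have h1 : ballVol 𝕜 ι ≤ (haarPi 𝕜 ι).real (flatShell 𝕜 ι δ s 1) +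
      ((haarPi 𝕜 ι).real (D ∩ {x | sqSum x ≤ 1}) +
        (haarPi 𝕜 ι).real (⋃ i ∈ Finset.univ, E i)) := by
    refine (measureReal_mono hcover ?_).trans ((measureReal_union_le _ _).trans ?_)
    · exact hfin _ (Set.union_subset hS (Set.union_subset Set.inter_subset_right hEsub))
    · gcongr
      exact measureReal_union_le _ _
  have h2 : (haarPi 𝕜 ι).real (D ∩ {x | sqSum x ≤ 1}) ≤
      (1 - δ) ^ (dysonIndex 𝕜 * Fintype.card ι / 2) * ballVol 𝕜 ι := by
    rw [← haarPi_real_sqSum_le (by linarith)]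
    exact measureReal_mono Set.inter_subset_left (haarPi_sqSum_le_lt_top _).ne
  have h3 : (haarPi 𝕜 ι).real (⋃ i ∈ Finset.univ, E i) ≤ Fintype.card ι *
      (Real.exp (-(dysonIndex 𝕜 * s * (Fintype.card ι - 1) / 4)) * (2 / s) ^ (dysonIndex 𝕜 / 2)) *
        ballVol 𝕜 ι := by
    refine (measureReal_biUnion_finset_le _ _).trans
      ((Finset.sum_le_sum fun i _ => haarPi_real_large_coord_le i hs hs1).trans_eq ?_)
    simp only [Finset.sum_const, Finset.card_univ, nsmul_eq_mul]
    ring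
  linarith

lemma flatShell_volume {δ s t : ℝ} (ht : 0 < t) :
    (haarPi 𝕜 ι).real (flatShell 𝕜 ι δ s t) =
      t ^ (dysonIndex 𝕜 * Fintype.card ι / 2) * (haarPi 𝕜 ι).real (flatShell 𝕜 ι δ s 1) := by
  rw [← haarPi_real_scale ht]
  congr 1
  ext x
  simp only [flatShell, Set.mem_ofPred_eq, sqSum_smul, inv_pow, Real.sq_sqrt ht.le, Pi.smul_apply,
    norm_smul, mul_pow, norm_inv, Real.norm_eq_abs, abs_of_nonneg (Real.sqrt_nonneg t)]
  simp only [inv_mul_le_iff₀ ht, le_inv_mul_iff₀ ht, mul_one, one_mul, mul_comm t]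

end Delocalization

/-! ### The uniform measure of the sphere as a relative volume of cones. -/

section Sphere

variable {𝕜 : Type*} [RCLike 𝕜] {N : ℕ}

/-- Uniqueness of Haar measure up to a factor. The value of `c` is irrelevant, as it cancels in the
normalized measure of the sphere. -/
lemma exists_map_addHaar : ∃ c : ENNReal, c ≠ 0 ∧ c ≠ ⊤ ∧ ∀ B : Set (Fin N → 𝕜),
    (Measure.addHaar : Measure (EuclideanSpace 𝕜 (Fin N))) {x | x.ofLp ∈ B} =
      c * haarPi 𝕜 (Fin N) B := by
  let T : EuclideanSpace 𝕜 (Fin N) ≃L[ℝ] (Fin N → 𝕜) :=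
    PiLp.continuousLinearEquiv 2 ℝ fun _ : Fin N => 𝕜
  have hT : ((Measure.addHaar : Measure (EuclideanSpace 𝕜 (Fin N))).map T).IsAddHaarMeasure :=
    T.isAddHaarMeasure_map _
  have h := Measure.isAddLeftInvariant_eq_smul
    ((Measure.addHaar : Measure (EuclideanSpace 𝕜 (Fin N))).map T) (haarPi 𝕜 (Fin N))
  set c := Measure.addHaarScalarFactor
    ((Measure.addHaar : Measure (EuclideanSpace 𝕜 (Fin N))).map T) (haarPi 𝕜 (Fin N))
  have hc : c ≠ 0 := (Measure.addHaarScalarFactor_pos_of_isAddHaarMeasure _ _).ne'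
  refine ⟨c, by exact_mod_cast hc, ENNReal.coe_ne_top, fun B => ?_⟩
  have h2 : (Measure.addHaar : Measure (EuclideanSpace 𝕜 (Fin N))).map
      T.toHomeomorph.toMeasurableEquiv B = c * haarPi 𝕜 (Fin N) B := by
    change (Measure.addHaar : Measure (EuclideanSpace 𝕜 (Fin N))).map T B = _
    rw [h]; rfl
  rw [MeasurableEquiv.map_apply] at h2
  exact h2

lemma norm_sq_eq_sqSum (x : EuclideanSpace 𝕜 (Fin N)) : ‖x‖ ^ 2 = sqSum x.ofLp := by
  rw [EuclideanSpace.norm_sq_eq]; rfl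

-- The surface measure of a set is the dimension times the volume of the open cone over it; after
-- normalization the dimension and the Haar constant disappear.
open scoped Pointwise in
lemma uniformSphere_apply (hN : 0 < N) {A : Set (USphere 𝕜 N)} (hA : MeasurableSet A) :
    (uniformSphere 𝕜 N).real A = (haarPi 𝕜 (Fin N)).real
      {x | ∃ e ∈ A, ∃ r : ℝ, 0 < r ∧ r < 1 ∧ x = r • e.1.ofLp} / ballVol 𝕜 (Fin N) := by
  have : Nonempty (Fin N) := ⟨⟨0, hN⟩⟩
  have : Nontrivial (EuclideanSpace 𝕜 (Fin N)) :=
    (WithLp.toLp_injective 2 (V := Fin N → 𝕜)).nontrivial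
  obtain ⟨c, hc0, hct, hc⟩ := exists_map_addHaar (𝕜 := 𝕜) (N := N)
  have hball : (Measure.addHaar : Measure (EuclideanSpace 𝕜 (Fin N))) (Metric.ball 0 1) =
      c * haarPi 𝕜 (Fin N) {x | sqSum x ≤ 1} := by
    rw [← hc, ← Measure.addHaar_unitClosedBall_eq_addHaar_unitBall]
    congr 1
    ext x
    rw [mem_closedBall_zero_iff, Set.mem_ofPred_eq, Set.mem_ofPred_eq, ← norm_sq_eq_sqSum,
      sq_le_one_iff₀ (norm_nonneg _)]
  have hd : ((Module.finrank ℝ (EuclideanSpace 𝕜 (Fin N)) : ℕ) : ENNReal) ≠ 0 := by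
    exact_mod_cast Module.finrank_pos.ne'
  rw [uniformSphere, Measure.real, Measure.smul_apply, Measure.toSphere_apply' _ hA,
    Measure.toSphere_apply_univ, hball]
  have hcone : (Measure.addHaar : Measure (EuclideanSpace 𝕜 (Fin N)))
      (Set.Ioo (0 : ℝ) 1 • ((↑) '' A : Set (EuclideanSpace 𝕜 (Fin N)))) = c * haarPi 𝕜 (Fin N)
        {x | ∃ e ∈ A, ∃ r : ℝ, 0 < r ∧ r < 1 ∧ x = r • e.1.ofLp} := by
    rw [← hc]
    congr 1
    ext x
    simp only [Set.mem_smul, Set.mem_image, Set.mem_Ioo, Set.mem_ofPred_eq]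
    constructor
    · rintro ⟨r, ⟨h0, h1⟩, _, ⟨e, he, rfl⟩, rfl⟩
      exact ⟨e, he, r, h0, h1, rfl⟩
    · rintro ⟨e, he, r, h0, h1, h⟩
      refine ⟨r, ⟨h0, h1⟩, _, ⟨e, he, rfl⟩, ?_⟩
      exact (WithLp.ofLp_injective 2 h).symm
  rw [hcone]
  simp only [smul_eq_mul, ENNReal.toReal_mul, ENNReal.toReal_inv]
  have e1 : c.toReal ≠ 0 := (ENNReal.toReal_pos hc0 hct).ne'
  have e2 : ((Module.finrank ℝ (EuclideanSpace 𝕜 (Fin N)) : ℕ) : ENNReal).toReal ≠ 0 :=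
    (ENNReal.toReal_pos hd (ENNReal.natCast_ne_top _)).ne'
  have e3 : (haarPi 𝕜 (Fin N) {x | sqSum x ≤ 1}).toReal = ballVol 𝕜 (Fin N) := rfl
  have e4 : ballVol 𝕜 (Fin N) ≠ 0 := ballVol_pos.ne'
  rw [e3, Measure.real]
  field_simp

lemma isProbabilityMeasure_uniformSphere (hN : 0 < N) :
    IsProbabilityMeasure (uniformSphere 𝕜 N) := by
  have : Nonempty (Fin N) := ⟨⟨0, hN⟩⟩
  have : Nontrivial (EuclideanSpace 𝕜 (Fin N)) :=
    (WithLp.toLp_injective 2 (V := Fin N → 𝕜)).nontrivial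
  refine ⟨?_⟩
  rw [uniformSphere, Measure.smul_apply, smul_eq_mul, ENNReal.inv_mul_cancel]
  · exact fun h => Measure.toSphere_ne_zero _ (Measure.measure_univ_eq_zero.1 h)
  · exact measure_ne_top _ _

/-- An upper bound on the measure of a set of the sphere whose cone is contained in `B`. -/
lemma uniformSphere_le (hN : 0 < N) {A : Set (USphere 𝕜 N)} (hA : MeasurableSet A)
    {B : Set (Fin N → 𝕜)} (hB : haarPi 𝕜 (Fin N) B ≠ ⊤)
    (h : ∀ e ∈ A, ∀ r : ℝ, 0 < r → r < 1 → r • e.1.ofLp ∈ B) :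
    (uniformSphere 𝕜 N).real A ≤ (haarPi 𝕜 (Fin N)).real B / ballVol 𝕜 (Fin N) := by
  rw [uniformSphere_apply hN hA]
  refine div_le_div_of_nonneg_right (measureReal_mono ?_ hB) ballVol_pos.le
  rintro x ⟨e, he, r, h0, h1, rfl⟩
  exact h e he r h0 h1

/-- A lower bound on the measure of a set of the sphere whose cone contains `B`. -/
lemma le_uniformSphere (hN : 0 < N) {A : Set (USphere 𝕜 N)} (hA : MeasurableSet A)
    {B : Set (Fin N → 𝕜)} (hB0 : ∀ x ∈ B, 0 < sqSum x) (hB1 : ∀ x ∈ B, sqSum x < 1)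
    (h : ∀ e : USphere 𝕜 N, ∀ r : ℝ, 0 < r → r < 1 → r • e.1.ofLp ∈ B → e ∈ A) :
    (haarPi 𝕜 (Fin N)).real B / ballVol 𝕜 (Fin N) ≤ (uniformSphere 𝕜 N).real A := by
  rw [uniformSphere_apply hN hA]
  refine div_le_div_of_nonneg_right (measureReal_mono ?_ ?_) ballVol_pos.le
  · intro x hx
    have hr0 : 0 < √(sqSum x) := Real.sqrt_pos.2 (hB0 x hx)
    have hr1 : √(sqSum x) < 1 := by
      rw [Real.sqrt_lt' one_pos]; simpa using hB1 x hx
    have hn : ‖WithLp.toLp 2 x‖ = √(sqSum x) := by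
      rw [EuclideanSpace.norm_eq]; rfl
    have hx' : x = √(sqSum x) • ((√(sqSum x))⁻¹ • x) := by
      rw [smul_smul, mul_inv_cancel₀ hr0.ne', one_smul]
    let e : USphere 𝕜 N := ⟨(√(sqSum x))⁻¹ • WithLp.toLp 2 x, by
      rw [mem_sphere_zero_iff_norm, norm_smul, norm_inv, Real.norm_eq_abs, abs_of_pos hr0, hn,
        inv_mul_cancel₀ hr0.ne']⟩
    refine ⟨e, h e _ hr0 hr1 ?_, _, hr0, hr1, hx'⟩
    change √(sqSum x) • ((√(sqSum x))⁻¹ • x) ∈ B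
    rwa [← hx']
  · refine ((measure_mono ?_).trans_lt
      (haarPi_sqSum_le_lt_top (𝕜 := 𝕜) (ι := Fin N) 1)).ne
    rintro x ⟨e, he, r, h0, h1, rfl⟩
    have he1 : sqSum e.1.ofLp = 1 := by
      rw [← norm_sq_eq_sqSum, mem_sphere_zero_iff_norm.1 e.2, one_pow]
    rw [Set.mem_ofPred_eq, sqSum_smul, he1, mul_one]
    nlinarith

end Sphere

/-! ### Laplace transform of a real centered variable near the origin. -/

section Laplace

/-- A third-order lower bound valid on the whole line, so that it can be integrated without
truncation. For `x ≤ -1` the left side is `(1 + x) (1 + x² / 2) ≤ 0`. -/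
lemma one_add_add_sub_le_exp (x : ℝ) : 1 + x + x ^ 2 / 2 - |x| ^ 3 / 2 ≤ Real.exp x := by
  rcases le_total 0 x with h | h
  · have := Real.quadratic_le_exp_of_nonneg h
    have h3 : 0 ≤ |x| ^ 3 := by positivity
    linarith
  · rcases le_total (-1) x with h1 | h1
    · have habs : |x| ≤ 1 := abs_le.2 ⟨h1, h.trans zero_le_one⟩
      have := Real.exp_bound habs (n := 3) (by norm_num)
      simp only [Finset.sum_range_succ, Finset.sum_range_zero, Nat.factorial] at this
      have h3 : 0 ≤ |x| ^ 3 := by positivity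
      have := (abs_le.1 this).1
      norm_num at this
      linarith
    · have := Real.exp_pos x
      rw [abs_of_nonpos h]
      nlinarith [mul_nonneg (neg_nonneg.2 (by linarith : 1 + x ≤ 0)) (sq_nonneg x)]

lemma abs_pow_le_exp (x : ℝ) (k : ℕ) :
    |x| ^ k ≤ k.factorial * (Real.exp x + Real.exp (-x)) := by
  have h1 := Real.pow_div_factorial_le_exp |x| (abs_nonneg x) k
  rw [div_le_iff₀ (by positivity)] at h1
  have h2 := Real.exp_abs_le x
  nlinarith [mul_le_mul_of_nonneg_right h2 (by positivity : (0 : ℝ) ≤ k.factorial)]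

variable {Ω : Type*} [MeasurableSpace Ω] {P : Measure Ω}

lemma integrable_exp_of_lintegral {Y : Ω → ℝ} (hY : AEMeasurable Y P)
    (h : ∫⁻ ω, ENNReal.ofReal (Real.exp (Y ω)) ∂P < ⊤) :
    Integrable (fun ω => Real.exp (Y ω)) P := by
  refine ⟨hY.exp.aestronglyMeasurable, ?_⟩
  rw [hasFiniteIntegral_iff_ofReal (Eventually.of_forall fun ω => (Real.exp_pos _).le)]
  exact h

lemma integrable_abs_pow {Y : Ω → ℝ} (hY : AEMeasurable Y P)
    (h1 : Integrable (fun ω => Real.exp (Y ω)) P)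
    (h2 : Integrable (fun ω => Real.exp (-Y ω)) P) (k : ℕ) :
    Integrable (fun ω => |Y ω| ^ k) P := by
  refine ((h1.add h2).const_mul (k.factorial : ℝ)).mono'
    (hY.norm.pow_const k).aestronglyMeasurable (Eventually.of_forall fun ω => ?_)
  rw [Real.norm_of_nonneg (by positivity)]
  exact abs_pow_le_exp _ _

/-- The Laplace transform of a centered sub-Gaussian variable near the origin. -/
lemma exp_le_lintegral_exp [IsProbabilityMeasure P] {Y : Ω → ℝ} (hY : AEMeasurable Y P)
    (h0 : ∫ ω, Y ω ∂P = 0) {v : ℝ} (hv : ∫ ω, Y ω ^ 2 ∂P = v) (hv1 : 1 / 2 ≤ v) (hv2 : v ≤ 2)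
    (hp : ∫⁻ ω, ENNReal.ofReal (Real.exp (Y ω)) ∂P ≤ ENNReal.ofReal (Real.exp (v / 2)))
    (hm : ∫⁻ ω, ENNReal.ofReal (Real.exp (-Y ω)) ∂P ≤ ENNReal.ofReal (Real.exp (v / 2)))
    {δ t : ℝ} (hδ : 0 < δ) (hδ1 : δ ≤ 1) (ht : 0 ≤ t) (ht1 : t ≤ δ / 72) :
    ENNReal.ofReal (Real.exp ((1 - δ) * (v * t ^ 2 / 2))) ≤
      ∫⁻ ω, ENNReal.ofReal (Real.exp (t * Y ω)) ∂P := by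
  have ip := integrable_exp_of_lintegral hY (hp.trans_lt ENNReal.ofReal_lt_top)
  have im := integrable_exp_of_lintegral hY.neg (hm.trans_lt ENNReal.ofReal_lt_top)
  simp only [Pi.neg_apply] at im
  have i1 : Integrable Y P := by
    have := integrable_abs_pow hY ip im 1
    simp only [pow_one] at this
    exact (integrable_norm_iff hY.aestronglyMeasurable).1 this
  have i2 : Integrable (fun ω => Y ω ^ 2) P := by
    simpa using integrable_abs_pow hY ip im 2
  have i3 := integrable_abs_pow hY ip im 3
  have bound : ∀ {Z : Ω → ℝ}, Integrable (fun ω => Real.exp (Z ω)) P →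
      ∫⁻ ω, ENNReal.ofReal (Real.exp (Z ω)) ∂P ≤ ENNReal.ofReal (Real.exp (v / 2)) →
      ∫ ω, Real.exp (Z ω) ∂P ≤ Real.exp 1 := by
    intro Z hZ h
    rw [← ofReal_integral_eq_lintegral_ofReal hZ
      (Eventually.of_forall fun ω => (Real.exp_pos _).le),
      ENNReal.ofReal_le_ofReal_iff (Real.exp_pos _).le] at h
    exact h.trans (Real.exp_le_exp.2 (by linarith))
  have bp := bound ip hp
  have bm := bound im hm
  -- The constant comes from `|Y|³ ≤ 3! (exp Y + exp (-Y))` and from both exponential moments being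
  -- at most `e`: `12 e < 33`.
  have b3 : ∫ ω, |Y ω| ^ 3 ∂P ≤ 33 := by
    calc ∫ ω, |Y ω| ^ 3 ∂P
        ≤ ∫ ω, ((Nat.factorial 3 : ℕ) : ℝ) * (Real.exp (Y ω) + Real.exp (-Y ω)) ∂P :=
          integral_mono i3 ((ip.add im).const_mul _) fun ω => abs_pow_le_exp _ _
      _ = 6 * (∫ ω, Real.exp (Y ω) ∂P + ∫ ω, Real.exp (-Y ω) ∂P) := by
          rw [integral_const_mul, integral_add ip im]
          norm_num [Nat.factorial]
      _ ≤ 33 := by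
          have := Real.exp_one_lt_d9
          linarith
  have ilow : Integrable (fun ω => 1 + t * Y ω + t ^ 2 / 2 * Y ω ^ 2 - t ^ 3 / 2 * |Y ω| ^ 3) P :=
    (((integrable_const _).add (i1.const_mul _)).add (i2.const_mul _)).sub (i3.const_mul _)
  have hint : ∫ ω, (1 + t * Y ω + t ^ 2 / 2 * Y ω ^ 2 - t ^ 3 / 2 * |Y ω| ^ 3) ∂P =
      1 + t ^ 2 / 2 * v - t ^ 3 / 2 * ∫ ω, |Y ω| ^ 3 ∂P := by
    have j1 : Integrable (fun ω => t * Y ω) P := i1.const_mul _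
    have j2 : Integrable (fun ω => t ^ 2 / 2 * Y ω ^ 2) P := i2.const_mul _
    have j3 : Integrable (fun ω => t ^ 3 / 2 * |Y ω| ^ 3) P := i3.const_mul _
    have j4 : Integrable (fun ω => 1 + t * Y ω) P := (integrable_const _).add j1
    have j5 : Integrable (fun ω => 1 + t * Y ω + t ^ 2 / 2 * Y ω ^ 2) P := j4.add j2
    rw [integral_sub j5 j3, integral_add j4 j2, integral_add (integrable_const _) j1,
      integral_const_mul, integral_const_mul, integral_const_mul, h0, hv]
    simp
  have hexp : Real.exp ((1 - δ) * (v * t ^ 2 / 2)) ≤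
      1 + t ^ 2 / 2 * v - t ^ 3 / 2 * ∫ ω, |Y ω| ^ 3 ∂P := by
    set y := (1 - δ) * (v * t ^ 2 / 2) with hy
    have ht2 : t ≤ 1 / 72 := by linarith
    have hy0 : 0 ≤ y := by rw [hy]; apply mul_nonneg <;> [linarith; positivity]
    have hyt : y ≤ t ^ 2 := by
      have h1 : v * t ^ 2 / 2 ≤ t ^ 2 := by nlinarith [sq_nonneg t]
      have h2 : 0 ≤ v * t ^ 2 / 2 := by positivity
      nlinarith
    have hy1 : y ≤ 1 := by nlinarith
    have h1 : Real.exp y ≤ 1 + y + y ^ 2 := by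
      have := Real.abs_exp_sub_one_sub_id_le (x := y) (by rw [abs_of_nonneg hy0]; exact hy1)
      have := (abs_le.1 this).2
      linarith
    have h2 : t ^ 3 / 2 * ∫ ω, |Y ω| ^ 3 ∂P ≤ t ^ 3 / 2 * 33 := by gcongr
    have h3 : y ^ 2 ≤ t ^ 3 := by
      have : y ^ 2 ≤ (t ^ 2) ^ 2 := by gcongr
      have h5 : 0 ≤ t ^ 3 := by positivity
      nlinarith
    -- The errors `33 t³ / 2` and `y² ≤ t³` add up to less than `18 t³`, to be absorbed by `δ v t² /
    -- 2 ≥ δ t² / 4`. This requires `t ≤ δ / 72`.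
    have h4 : t ^ 3 * 18 ≤ t ^ 2 * (δ / 4) := by nlinarith [sq_nonneg t]
    have h5 : t ^ 2 * (δ / 4) ≤ δ * (v * t ^ 2 / 2) := by
      have : 0 ≤ δ * t ^ 2 := by positivity
      nlinarith
    have h6 : y = v * t ^ 2 / 2 - δ * (v * t ^ 2 / 2) := by rw [hy]; ring
    have h7 : 0 ≤ t ^ 3 := by positivity
    linarith
  have it : Integrable (fun ω => Real.exp (t * Y ω)) P := by
    refine (ip.add im).mono' (hY.const_mul t).exp.aestronglyMeasurable
      (Eventually.of_forall fun ω => ?_)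
    rw [Real.norm_of_nonneg (Real.exp_pos _).le]
    refine (Real.exp_le_exp.2 ?_).trans (Real.exp_abs_le (Y ω))
    refine (le_abs_self _).trans ?_
    rw [abs_mul, abs_of_nonneg ht]
    exact mul_le_of_le_one_left (abs_nonneg _) (by linarith)
  rw [← ofReal_integral_eq_lintegral_ofReal it (Eventually.of_forall fun ω => (Real.exp_pos _).le)]
  refine ENNReal.ofReal_le_ofReal ((hexp.trans_eq hint.symm).trans
    (integral_mono ilow it fun ω => ?_))
  have := one_add_add_sub_le_exp (t * Y ω)
  rw [abs_mul, abs_of_nonneg ht] at this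
  dsimp only
  nlinarith

end Laplace

/-! ### Moments and Laplace transforms of a single matrix entry. -/

section Entries

variable {𝕜 : Type*} [RCLike 𝕜]

lemma dysonIndex_cases :
    ((∀ z : 𝕜, RCLike.im z = 0) ∧ dysonIndex 𝕜 = 1) ∨ dysonIndex 𝕜 = 2 := by
  rcases RCLike.I_eq_zero_or_im_I_eq_one (K := 𝕜) with h | h
  · left
    refine ⟨fun z => RCLike.im_eq_zero h z, ?_⟩
    rw [dysonIndex, (RCLike.realLinearIsometryEquiv h).toLinearEquiv.finrank_eq]
    simp
  · right
    rw [dysonIndex, (RCLike.complexLinearIsometryEquiv h).toLinearEquiv.finrank_eq]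
    simp [Complex.finrank_real_complex]

lemma re_conj_mul (u x : 𝕜) :
    RCLike.re (starRingEnd 𝕜 u * x) =
      RCLike.re u * RCLike.re x + RCLike.im u * RCLike.im x := by
  simp [RCLike.mul_re]

variable {Ω : Type*} [MeasurableSpace Ω] {P : Measure Ω} {X : Ω → 𝕜}

lemma measurable_re_conj_mul (hX : Measurable X) (u : 𝕜) :
    Measurable fun ω => RCLike.re (starRingEnd 𝕜 u * X ω) :=
  RCLike.measurable_re.comp (hX.const_mul _)

lemma SharpSubGaussian.lintegral_lt_top (hX : Measurable X) (hs : SharpSubGaussian (P.map X))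
    (u : 𝕜) :
    ∫⁻ ω, ENNReal.ofReal (Real.exp (RCLike.re (starRingEnd 𝕜 u * X ω))) ∂P < ⊤ := by
  have := hs u
  rw [lintegral_map (by fun_prop) hX] at this
  exact this.trans_lt ENNReal.ofReal_lt_top

lemma SharpSubGaussian.integrable_exp (hX : Measurable X) (hs : SharpSubGaussian (P.map X))
    (u : 𝕜) : Integrable (fun ω => Real.exp (RCLike.re (starRingEnd 𝕜 u * X ω))) P :=
  integrable_exp_of_lintegral (measurable_re_conj_mul hX u).aemeasurable (hs.lintegral_lt_top hX u)

/-- `IsWignerFamily` does not state that its moments are integrable. Integrability follows from the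
finiteness of the Laplace transform at `u` and `-u`. -/
lemma SharpSubGaussian.integrable_pow (hX : Measurable X) (hs : SharpSubGaussian (P.map X))
    (u : 𝕜) (k : ℕ) : Integrable (fun ω => |RCLike.re (starRingEnd 𝕜 u * X ω)| ^ k) P := by
  refine integrable_abs_pow (measurable_re_conj_mul hX u).aemeasurable (hs.integrable_exp hX u) ?_ k
  have := hs.integrable_exp hX (-u)
  simpa using this

lemma SharpSubGaussian.memLp_re (hX : Measurable X) (hs : SharpSubGaussian (P.map X)) :
    MemLp (fun ω => RCLike.re (X ω)) 2 P := by
  rw [memLp_two_iff_integrable_sq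
    (f := fun ω => RCLike.re (X ω)) (RCLike.measurable_re.comp hX).aestronglyMeasurable]
  have := hs.integrable_pow hX 1 2
  simpa using this

lemma SharpSubGaussian.memLp_im (hX : Measurable X) (hs : SharpSubGaussian (P.map X)) :
    MemLp (fun ω => RCLike.im (X ω)) 2 P := by
  rw [memLp_two_iff_integrable_sq
    (f := fun ω => RCLike.im (X ω)) (RCLike.measurable_im.comp hX).aestronglyMeasurable]
  rcases RCLike.I_eq_zero_or_im_I_eq_one (K := 𝕜) with h | h
  · simp [RCLike.im_eq_zero h]
  · have := hs.integrable_pow hX RCLike.I 2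
    simpa [re_conj_mul, h] using this

variable [IsProbabilityMeasure P]

lemma SharpSubGaussian.integral_eq_zero (hX : Measurable X) (hs : SharpSubGaussian (P.map X))
    (h0 : ∫ ω, X ω ∂P = 0) (u : 𝕜) : ∫ ω, RCLike.re (starRingEnd 𝕜 u * X ω) ∂P = 0 := by
  have i1 : Integrable X P := by
    have h1 := (hs.memLp_re hX).integrable one_le_two
    have h2 := (hs.memLp_im hX).integrable one_le_two
    have := (h1.ofReal (𝕜 := 𝕜)).add ((h2.ofReal (𝕜 := 𝕜)).mul_const RCLike.I)
    refine this.congr (Eventually.of_forall fun ω => ?_)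
    exact RCLike.re_add_im (X ω)
  have := integral_re (i1.const_mul (starRingEnd 𝕜 u))
  rw [this, integral_const_mul, h0]
  simp

lemma SharpSubGaussian.lintegral_exp_le (hX : Measurable X) (hs : SharpSubGaussian (P.map X))
    (h0 : ∫ ω, X ω ∂P = 0) (u : 𝕜) :
    ∫⁻ ω, ENNReal.ofReal (Real.exp (RCLike.re (starRingEnd 𝕜 u * X ω))) ∂P ≤
      ENNReal.ofReal (Real.exp ((∫ ω, RCLike.re (starRingEnd 𝕜 u * X ω) ^ 2 ∂P) / 2)) := by
  have := hs u
  rw [lintegral_map (by fun_prop) hX, variance_map (by fun_prop) hX.aemeasurable,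
    variance_of_integral_eq_zero] at this
  · exact this
  · exact (measurable_re_conj_mul hX u).aemeasurable
  · exact hs.integral_eq_zero hX h0 u

/-- Separating the direction `w` from the length `t` reduces the `𝕜`-valued entry to the real
variable `Re (conj w * X)`, whose variance `q` does not change with `t`. The upper bound is global,
the lower one only local. -/
lemma SharpSubGaussian.lintegral_exp_bounds (hX : Measurable X)
    (hs : SharpSubGaussian (P.map X)) (h0 : ∫ ω, X ω ∂P = 0) {w : 𝕜} {q : ℝ}
    (hq : ∫ ω, RCLike.re (starRingEnd 𝕜 w * X ω) ^ 2 ∂P = q) (hq1 : 1 / 2 ≤ q) (hq2 : q ≤ 2)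
    {t : ℝ} (ht : 0 ≤ t) :
    (∫⁻ ω, ENNReal.ofReal (Real.exp (RCLike.re (starRingEnd 𝕜 ((t : 𝕜) * w) * X ω))) ∂P ≤
      ENNReal.ofReal (Real.exp (q * t ^ 2 / 2))) ∧
    ∀ δ : ℝ, 0 < δ → δ ≤ 1 → t ≤ δ / 72 → ENNReal.ofReal (Real.exp ((1 - δ) * (q * t ^ 2 / 2))) ≤
      ∫⁻ ω, ENNReal.ofReal (Real.exp (RCLike.re (starRingEnd 𝕜 ((t : 𝕜) * w) * X ω))) ∂P := by
  have e : ∀ ω, RCLike.re (starRingEnd 𝕜 ((t : 𝕜) * w) * X ω) =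
      t * RCLike.re (starRingEnd 𝕜 w * X ω) := fun ω => by
    rw [map_mul (starRingEnd 𝕜), RCLike.conj_ofReal, mul_assoc, RCLike.re_ofReal_mul]
  constructor
  · refine (hs.lintegral_exp_le hX h0 _).trans_eq ?_
    simp_rw [e, mul_pow]
    rw [integral_const_mul, hq, mul_comm]
  · intro δ h1 h2 h3
    simp_rw [e]
    refine exp_le_lintegral_exp (measurable_re_conj_mul hX w).aemeasurable
      (hs.integral_eq_zero hX h0 w) hq hq1 hq2 ?_ ?_ h1 h2 ht h3
    · rw [← hq]
      exact hs.lintegral_exp_le hX h0 w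
    · have := hs.lintegral_exp_le hX h0 (-w)
      simp only [map_neg, neg_mul, neg_sq] at this
      rw [← hq]
      exact this

end Entries

/-! ### Averaging the exponential over the matrix for a fixed unit vector. -/

section Wigner

variable {𝕜 : Type*} [RCLike 𝕜] {Ω : Type*} [MeasurableSpace Ω] {P : Measure Ω}
  {N : ℕ} {a : Fin N → Fin N → Ω → 𝕜}

/-- The multiplicity of an index pair among the ordered pairs. -/
def pairMult {N : ℕ} (p : {p : Fin N × Fin N // p.1 ≤ p.2}) : ℝ := if p.1.1 = p.1.2 then 1 else 2

/-- Passes from all ordered pairs to the pairs `i ≤ j` that index the independent entries. -/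
lemma sum_symm_eq (f : Fin N → Fin N → ℝ) (hf : ∀ i j, f i j = f j i) :
    ∑ i, ∑ j, f i j = ∑ p : {p : Fin N × Fin N // p.1 ≤ p.2}, pairMult p * f p.1.1 p.1.2 := by
  set g : Fin N → Fin N → ℝ := fun i j => if i ≤ j then (if i = j then 1 else 2) * f i j else 0
  have h1 : ∑ p : {p : Fin N × Fin N // p.1 ≤ p.2}, pairMult p * f p.1.1 p.1.2 =
      ∑ i, ∑ j, g i j := by
    rw [← Fintype.sum_prod_type' g, ← Finset.sum_filter_add_sum_filter_not Finset.univ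
      (fun p : Fin N × Fin N => p.1 ≤ p.2) (fun p => g p.1 p.2)]
    rw [Finset.sum_eq_zero (s := Finset.univ.filter fun p : Fin N × Fin N => ¬p.1 ≤ p.2)
      (fun p hp => if_neg (Finset.mem_filter.1 hp).2), add_zero,
      Finset.sum_subtype (p := fun p : Fin N × Fin N => p.1 ≤ p.2) _ (by simp)]
    refine Finset.sum_congr rfl fun p _ => ?_
    simp only [pairMult, g, if_pos p.2]
  have h2 : ∀ i j, g i j + g j i = 2 * f i j := by
    intro i j
    rcases lt_trichotomy i j with h | h | h
    · simp [g, h.le, h.ne, h.not_ge]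
    · subst h; simp [g]; ring
    · simp [g, h.le, h.ne, h.not_ge, hf i j]
  have h3 : 2 * ∑ i, ∑ j, f i j = 2 * ∑ i, ∑ j, g i j := by
    simp_rw [Finset.mul_sum, ← h2, Finset.sum_add_distrib]
    rw [Finset.sum_comm (f := fun i j => g j i)]
    simp_rw [← Finset.mul_sum]
    ring
  rw [h1]
  linarith

/-- The coefficient of the entry `p` in the exponent `N θ ⟨e, X e⟩` is `2 θ √N A e_i conj e_j`,
or half of that on the diagonal. -/
noncomputable def entryCoeff (A : Matrix (Fin N) (Fin N) ℝ) (θ : ℝ) (e : USphere 𝕜 N)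
    (p : {p : Fin N × Fin N // p.1 ≤ p.2}) : 𝕜 :=
  ((pairMult p * (θ * √N * A p.1.1 p.1.2) : ℝ) : 𝕜) *
    (e.1 p.1.1 * starRingEnd 𝕜 (e.1 p.1.2))

lemma exponent_eq (hN : 0 < N) {A : Matrix (Fin N) (Fin N) ℝ} (hA : A.IsSymm) (θ : ℝ)
    (e : USphere 𝕜 N) (x : Fin N → Fin N → 𝕜) :
    N * θ * quadForm (modelMatrix A x) e =
      ∑ p, RCLike.re (starRingEnd 𝕜 (entryCoeff A θ e p) * x p.1.1 p.1.2) := by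
  have hN' : (0 : ℝ) < N := by exact_mod_cast hN
  have hs : 0 < √(N : ℝ) := Real.sqrt_pos.2 hN'
  set f : Fin N → Fin N → ℝ := fun i j =>
    RCLike.re (starRingEnd 𝕜 (e.1 i) * modelMatrix A x i j * e.1 j) with hf
  -- The diagonal is treated apart because `x i i` is not assumed real here; the real part in
  -- `quadForm` makes this harmless.
  have hsymm : ∀ i j, modelMatrix A x j i = starRingEnd 𝕜 (modelMatrix A x i j) ∨ i = j := by
    intro i j
    rcases lt_trichotomy i j with h | h | h
    · left
      simp [modelMatrix, wignerMatrix, h.le, h.not_ge, hA.apply i j]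
    · exact Or.inr h
    · left
      simp [modelMatrix, wignerMatrix, h.le, h.not_ge, hA.apply i j]
  have hf' : ∀ i j, f i j = f j i := by
    intro i j
    rcases hsymm i j with h | h
    · rw [hf]
      dsimp only
      rw [h, ← RCLike.conj_re]
      simp only [map_mul, RCLike.conj_conj]
      congr 1; ring
    · rw [h]
  have h1 : quadForm (modelMatrix A x) e = ∑ i, ∑ j, f i j := by
    simp only [quadForm, hf, map_sum]
  rw [h1, sum_symm_eq f hf', Finset.mul_sum]
  refine Finset.sum_congr rfl fun p _ => ?_
  rw [hf]
  dsimp only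
  rw [modelMatrix, Matrix.hadamard_apply, wignerMatrix, if_pos p.2, entryCoeff, Matrix.map_apply]
  have e1 : starRingEnd 𝕜 (((pairMult p * (θ * √N * A p.1.1 p.1.2) : ℝ) : 𝕜) *
      (e.1 p.1.1 * starRingEnd 𝕜 (e.1 p.1.2))) * x p.1.1 p.1.2 =
      ((pairMult p * (θ * √N * A p.1.1 p.1.2) : ℝ) : 𝕜) *
      (starRingEnd 𝕜 (e.1 p.1.1) * x p.1.1 p.1.2 * e.1 p.1.2) := by
    simp only [map_mul, RCLike.conj_conj, RCLike.conj_ofReal]; ring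
  have e2 : starRingEnd 𝕜 (e.1 p.1.1) * (x p.1.1 p.1.2 / ((√N : ℝ) : 𝕜) * (A p.1.1 p.1.2 : 𝕜)) *
      e.1 p.1.2 = ((A p.1.1 p.1.2 / √N : ℝ) : 𝕜) *
      (starRingEnd 𝕜 (e.1 p.1.1) * x p.1.1 p.1.2 * e.1 p.1.2) := by
    push_cast; ring
  rw [e1, e2, RCLike.re_ofReal_mul, RCLike.re_ofReal_mul]
  have : (N : ℝ) / √N = √N := Real.div_sqrt
  calc _ = (N / √N : ℝ) * (θ * pairMult p * A p.1.1 p.1.2) *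
        RCLike.re (starRingEnd 𝕜 (e.1 p.1.1) * x p.1.1 p.1.2 * e.1 p.1.2) := by ring
    _ = _ := by rw [this]; ring

lemma norm_entryCoeff (A : Matrix (Fin N) (Fin N) ℝ) {θ : ℝ} (hθ : 0 ≤ θ) (e : USphere 𝕜 N)
    (p : {p : Fin N × Fin N // p.1 ≤ p.2}) :
    ‖entryCoeff A θ e p‖ =
      pairMult p * (θ * √N * |A p.1.1 p.1.2|) * (‖e.1 p.1.1‖ * ‖e.1 p.1.2‖) := by
  have : 0 ≤ pairMult p := by unfold pairMult; split_ifs <;> norm_num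
  simp only [entryCoeff, norm_mul, RCLike.norm_ofReal, RCLike.norm_conj, abs_mul, abs_of_nonneg hθ,
    abs_of_nonneg (Real.sqrt_nonneg _), abs_of_nonneg this]

/-- Off the diagonal the covariance is isotropic, so the variance of `Re (conj u * a)` is `‖u‖² / β`
with `u` carrying the factor 2. On the diagonal the factor is 1 but the variance is `2 / β`. Both
halves of these variances equal `pairMult p` times the same expression, so the full double sum over
`i`, `j` reappears in the exponent. -/
lemma entry_bounds [IsProbabilityMeasure P] (ha : IsWignerFamily P a)
    (hsub : ∀ i j, i ≤ j → SharpSubGaussian (P.map (a i j)))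
    (A : Matrix (Fin N) (Fin N) ℝ) {θ : ℝ} (hθ : 0 ≤ θ) (e : USphere 𝕜 N)
    (p : {p : Fin N × Fin N // p.1 ≤ p.2}) :
    (∫⁻ ω, ENNReal.ofReal (Real.exp
        (RCLike.re (starRingEnd 𝕜 (entryCoeff A θ e p) * a p.1.1 p.1.2 ω))) ∂P ≤
      ENNReal.ofReal (Real.exp (pairMult p * (N * θ ^ 2 / dysonIndex 𝕜 *
        (A p.1.1 p.1.2 ^ 2 * ‖e.1 p.1.1‖ ^ 2 * ‖e.1 p.1.2‖ ^ 2))))) ∧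
    ∀ δ : ℝ, 0 < δ → δ ≤ 1 →
      2 * (θ * √N * |A p.1.1 p.1.2|) * (‖e.1 p.1.1‖ * ‖e.1 p.1.2‖) ≤ δ / 72 →
      ENNReal.ofReal (Real.exp (pairMult p * ((1 - δ) * (N * θ ^ 2 / dysonIndex 𝕜 *
        (A p.1.1 p.1.2 ^ 2 * ‖e.1 p.1.1‖ ^ 2 * ‖e.1 p.1.2‖ ^ 2))))) ≤
      ∫⁻ ω, ENNReal.ofReal (Real.exp
        (RCLike.re (starRingEnd 𝕜 (entryCoeff A θ e p) * a p.1.1 p.1.2 ω))) ∂P := by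
  obtain ⟨⟨i, j⟩, hij⟩ := p
  dsimp only at hij ⊢
  have hX := ha.measurable i j hij
  have hs := hsub i j hij
  have h0 := ha.centered i j hij
  have hNs : √(N : ℝ) ^ 2 = N := Real.sq_sqrt (Nat.cast_nonneg _)
  rcases hij.eq_or_lt with rfl | hlt
  · set c : ℝ := θ * √N * A i i * ‖e.1 i‖ ^ 2 with hc
    have hu : entryCoeff A θ e ⟨(i, i), hij⟩ = ((|c| : ℝ) : 𝕜) * ((SignType.sign c : ℝ) : 𝕜) := by
      rw [← RCLike.ofReal_mul, abs_mul_sign, entryCoeff, RCLike.mul_conj, pairMult, hc]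
      simp
    have hpm : pairMult (⟨(i, i), hij⟩ : {p : Fin N × Fin N // p.1 ≤ p.2}) = 1 := if_pos rfl
    -- The direction is the sign of `c`, which is a unit only if `c ≠ 0`.
    rcases eq_or_ne c 0 with hc0 | hc0
    · have hu0 : entryCoeff A θ e ⟨(i, i), hij⟩ = 0 := by rw [hu, hc0]; simp
      have hz : N * θ ^ 2 / dysonIndex 𝕜 * (A i i ^ 2 * ‖e.1 i‖ ^ 2 * ‖e.1 i‖ ^ 2) =
          c ^ 2 / dysonIndex 𝕜 := by rw [hc, mul_pow, mul_pow, mul_pow, hNs]; ring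
      rw [hz, hc0, hu0]
      simp
    have hsq : ((SignType.sign c : ℝ)) ^ 2 = 1 := by
      rcases lt_or_gt_of_ne hc0 with h | h <;> simp [h]
    have hq : ∫ ω, RCLike.re (starRingEnd 𝕜 ((SignType.sign c : ℝ) : 𝕜) * a i i ω) ^ 2 ∂P =
        2 / dysonIndex 𝕜 := by
      simp_rw [RCLike.conj_ofReal, RCLike.re_ofReal_mul, mul_pow, hsq, one_mul]
      exact ha.diag_var i
    have hb : 1 / 2 ≤ 2 / dysonIndex 𝕜 ∧ 2 / dysonIndex 𝕜 ≤ 2 := by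
      rcases dysonIndex_cases (𝕜 := 𝕜) with ⟨-, h⟩ | h <;> rw [h] <;> norm_num
    have key := hs.lintegral_exp_bounds hX h0 hq hb.1 hb.2 (abs_nonneg c)
    rw [← hu] at key
    have hval : 2 / dysonIndex 𝕜 * |c| ^ 2 / 2 =
        N * θ ^ 2 / dysonIndex 𝕜 * (A i i ^ 2 * ‖e.1 i‖ ^ 2 * ‖e.1 i‖ ^ 2) := by
      rw [sq_abs, hc, mul_pow, mul_pow, mul_pow, hNs]; ring
    rw [hval] at key
    rw [hpm, one_mul]
    refine ⟨key.1, fun δ h1 h2 h3 => ?_⟩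
    rw [one_mul]
    refine key.2 δ h1 h2 (le_trans ?_ h3)
    rw [hc]
    simp only [abs_mul, abs_of_nonneg hθ, abs_of_nonneg (Real.sqrt_nonneg _), abs_pow, abs_norm]
    have : 0 ≤ θ * √N * |A i i| * (‖e.1 i‖ * ‖e.1 i‖) := by positivity
    nlinarith
  · set u := entryCoeff A θ e ⟨(i, j), hij⟩ with hudef
    have hpm : pairMult (⟨(i, j), hij⟩ : {p : Fin N × Fin N // p.1 ≤ p.2}) = 2 := if_neg hlt.ne
    have hnorm : ‖u‖ = 2 * (θ * √N * |A i j|) * (‖e.1 i‖ * ‖e.1 j‖) := by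
      rw [hudef, norm_entryCoeff A hθ, hpm]
    have hquad : ∀ w : 𝕜, ∫ ω, RCLike.re (starRingEnd 𝕜 w * a i j ω) ^ 2 ∂P =
        1 / dysonIndex 𝕜 * ‖w‖ ^ 2 := by
      intro w
      have i1 : Integrable (fun ω => RCLike.re (a i j ω) ^ 2) P :=
        (hs.memLp_re hX).integrable_sq
      have i2 : Integrable (fun ω => RCLike.im (a i j ω) ^ 2) P :=
        (hs.memLp_im hX).integrable_sq
      have i3 : Integrable (fun ω => RCLike.re (a i j ω) * RCLike.im (a i j ω)) P :=
        (hs.memLp_re hX).integrable_mul (hs.memLp_im hX)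
      have hexp : ∀ ω, RCLike.re (starRingEnd 𝕜 w * a i j ω) ^ 2 =
          RCLike.re w ^ 2 * RCLike.re (a i j ω) ^ 2 + RCLike.im w ^ 2 * RCLike.im (a i j ω) ^ 2 +
            2 * RCLike.re w * RCLike.im w * (RCLike.re (a i j ω) * RCLike.im (a i j ω)) := by
        intro ω; rw [re_conj_mul]; ring
      simp_rw [hexp]
      have j1 := i1.const_mul (RCLike.re w ^ 2)
      have j2 := i2.const_mul (RCLike.im w ^ 2)
      have j3 : Integrable (fun ω => RCLike.re w ^ 2 * RCLike.re (a i j ω) ^ 2 +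
          RCLike.im w ^ 2 * RCLike.im (a i j ω) ^ 2) P := j1.add j2
      rw [integral_add j3 (i3.const_mul _), integral_add j1 j2, integral_const_mul,
        integral_const_mul,
        integral_const_mul, ha.offdiag_re i j hlt, ha.offdiag_im i j hlt,
        ha.offdiag_re_im i j hlt, RCLike.norm_sq_eq_def]
      rcases dysonIndex_cases (𝕜 := 𝕜) with ⟨h, h'⟩ | h'
      · rw [h', h w]; ring
      · rw [h']; ring
    obtain ⟨w, hw, huw⟩ : ∃ w : 𝕜, ‖w‖ = 1 ∧ u = ((‖u‖ : ℝ) : 𝕜) * w := by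
      rcases eq_or_ne u 0 with h | h
      · exact ⟨1, norm_one, by rw [h]; simp⟩
      · refine ⟨((‖u‖ : ℝ) : 𝕜)⁻¹ * u, ?_, ?_⟩
        · rw [norm_mul, norm_inv, RCLike.norm_ofReal, abs_norm,
            inv_mul_cancel₀ (norm_ne_zero_iff.2 h)]
        · rw [mul_inv_cancel_left₀]
          exact_mod_cast norm_ne_zero_iff.2 h
    have hq := hquad w
    rw [hw, one_pow, mul_one] at hq
    have hb : 1 / 2 ≤ 1 / dysonIndex 𝕜 ∧ 1 / dysonIndex 𝕜 ≤ 2 := by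
      rcases dysonIndex_cases (𝕜 := 𝕜) with ⟨-, h⟩ | h <;> rw [h] <;> norm_num
    have key := hs.lintegral_exp_bounds hX h0 hq hb.1 hb.2 (norm_nonneg u)
    rw [← huw] at key
    have hval : 1 / dysonIndex 𝕜 * ‖u‖ ^ 2 / 2 =
        2 * (N * θ ^ 2 / dysonIndex 𝕜 * (A i j ^ 2 * ‖e.1 i‖ ^ 2 * ‖e.1 j‖ ^ 2)) := by
      rw [hnorm, mul_pow, mul_pow, mul_pow, mul_pow, hNs, sq_abs]; ring
    rw [hval] at key
    rw [hpm]
    refine ⟨key.1, fun δ h1 h2 h3 => ?_⟩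
    rw [mul_left_comm]
    exact key.2 δ h1 h2 (hnorm.trans_le h3)

lemma lintegral_exponent_eq (hN : 0 < N) (ha : IsWignerFamily P a)
    {A : Matrix (Fin N) (Fin N) ℝ} (hA : A.IsSymm) (θ : ℝ) (e : USphere 𝕜 N) :
    ∫⁻ ω, ENNReal.ofReal (Real.exp (N * θ * quadForm (modelMatrix A fun i j => a i j ω) e)) ∂P =
      ∏ p : {p : Fin N × Fin N // p.1 ≤ p.2}, ∫⁻ ω, ENNReal.ofReal (Real.exp
        (RCLike.re (starRingEnd 𝕜 (entryCoeff A θ e p) * a p.1.1 p.1.2 ω))) ∂P := by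
  have hmeas : ∀ u : 𝕜, Measurable fun x : 𝕜 =>
      ENNReal.ofReal (Real.exp (RCLike.re (starRingEnd 𝕜 u * x))) := fun u => by fun_prop
  rw [← lintegral_prod_eq_prod_lintegral_of_indepFun Finset.univ
    (fun (p : {p : Fin N × Fin N // p.1 ≤ p.2}) ω => ENNReal.ofReal (Real.exp
        (RCLike.re (starRingEnd 𝕜 (entryCoeff A θ e p) * a p.1.1 p.1.2 ω))))
    (ha.indep.comp _ fun p => hmeas (entryCoeff A θ e p))
    fun p => (hmeas _).comp (ha.measurable _ _ p.2)]
  refine lintegral_congr fun ω => ?_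
  rw [exponent_eq hN hA θ e, Real.exp_sum,
    ENNReal.ofReal_prod_of_nonneg fun _ _ => (Real.exp_pos _).le]

lemma lintegral_exponent_le [IsProbabilityMeasure P] (hN : 0 < N) (ha : IsWignerFamily P a)
    (hsub : ∀ i j, i ≤ j → SharpSubGaussian (P.map (a i j)))
    {A : Matrix (Fin N) (Fin N) ℝ} (hA : A.IsSymm) {θ : ℝ} (hθ : 0 ≤ θ) (e : USphere 𝕜 N) :
    ∫⁻ ω, ENNReal.ofReal (Real.exp (N * θ * quadForm (modelMatrix A fun i j => a i j ω) e)) ∂P ≤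
      ENNReal.ofReal (Real.exp (N * θ ^ 2 / dysonIndex 𝕜 *
        ∑ i, ∑ j, A i j ^ 2 * ‖e.1 i‖ ^ 2 * ‖e.1 j‖ ^ 2)) := by
  rw [lintegral_exponent_eq hN ha hA, sum_symm_eq (fun i j => A i j ^ 2 * ‖e.1 i‖ ^ 2 * ‖e.1 j‖ ^ 2)
    (fun i j => by rw [hA.apply]; ring), Finset.mul_sum, Real.exp_sum,
    ENNReal.ofReal_prod_of_nonneg fun _ _ => (Real.exp_pos _).le]
  refine Finset.prod_le_prod' fun p _ => ?_
  rw [mul_left_comm]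
  exact (entry_bounds ha hsub A hθ e p).1

lemma le_lintegral_exponent [IsProbabilityMeasure P] (hN : 0 < N) (ha : IsWignerFamily P a)
    (hsub : ∀ i j, i ≤ j → SharpSubGaussian (P.map (a i j)))
    {A : Matrix (Fin N) (Fin N) ℝ} (hA : A.IsSymm) {θ : ℝ} (hθ : 0 ≤ θ) (e : USphere 𝕜 N)
    {δ : ℝ} (hδ : 0 < δ) (hδ1 : δ ≤ 1)
    (he : ∀ i j, 2 * (θ * √N * |A i j|) * (‖e.1 i‖ * ‖e.1 j‖) ≤ δ / 72) :
    ENNReal.ofReal (Real.exp ((1 - δ) * (N * θ ^ 2 / dysonIndex 𝕜 *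
        ∑ i, ∑ j, A i j ^ 2 * ‖e.1 i‖ ^ 2 * ‖e.1 j‖ ^ 2))) ≤
      ∫⁻ ω, ENNReal.ofReal
        (Real.exp (N * θ * quadForm (modelMatrix A fun i j => a i j ω) e)) ∂P := by
  rw [lintegral_exponent_eq hN ha hA, sum_symm_eq (fun i j => A i j ^ 2 * ‖e.1 i‖ ^ 2 * ‖e.1 j‖ ^ 2)
    (fun i j => by rw [hA.apply]; ring), Finset.mul_sum, Finset.mul_sum, Real.exp_sum,
    ENNReal.ofReal_prod_of_nonneg fun _ _ => (Real.exp_pos _).le]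
  refine Finset.prod_le_prod' fun p _ => ?_
  rw [mul_left_comm _ (pairMult p), mul_left_comm _ (pairMult p)]
  exact (entry_bounds ha hsub A hθ e p).2 δ hδ hδ1 (he _ _)

end Wigner

/-! ### The variational problem: reduction from probability measures to the simplex. -/

namespace PiecewiseProfile

variable {n : ℕ} (S : PiecewiseProfile n)

lemma nat_pos (S : PiecewiseProfile n) : 0 < n := by
  rcases Nat.eq_zero_or_pos n with h | h
  · subst h
    have := S.α_sum
    simp at this
  · exact h

lemma interval_disjoint {k l : Fin n} {x : unitInterval} (hk : x ∈ S.interval k)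
    (hl : x ∈ S.interval l) : k = l := by
  have aux : ∀ {k l : Fin n}, x ∈ S.interval k → x ∈ S.interval l → ¬k < l := by
    intro k l hk hl h
    have h1 : ∑ i ∈ Finset.Iic k, S.α i ≤ ∑ i ∈ Finset.Iio l, S.α i :=
      Finset.sum_le_sum_of_subset_of_nonneg
        (fun i hi => Finset.mem_Iio.2 ((Finset.mem_Iic.1 hi).trans_lt h))
        fun i _ _ => (S.α_pos i).le
    rcases hk.2 with h2 | ⟨h2, -⟩
    · linarith [hl.1]
    · have := l.2
      have : (k : ℕ) < l := h
      omega
  rcases lt_trichotomy k l with h | h | h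
  · exact absurd h (aux hk hl)
  · exact h
  · exact absurd h (aux hl hk)

lemma exists_mem_interval (x : unitInterval) : ∃ k, x ∈ S.interval k := by
  have hn := S.nat_pos
  set T : Finset (Fin n) := Finset.univ.filter fun k => ∑ i ∈ Finset.Iio k, S.α i ≤ (x : ℝ)
  have hT : T.Nonempty := by
    refine ⟨⟨0, hn⟩, Finset.mem_filter.2 ⟨Finset.mem_univ _, ?_⟩⟩
    have : Finset.Iio (⟨0, hn⟩ : Fin n) = ∅ := by
      ext i; simp [Fin.lt_def]
    rw [this, Finset.sum_empty]
    exact x.2.1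
  set k := T.max' hT
  have hk := T.max'_mem hT
  refine ⟨k, (Finset.mem_filter.1 hk).2, ?_⟩
  by_cases hlast : (k : ℕ) + 1 = n
  · have : Finset.Iic k = Finset.univ := by
      ext i
      simp only [Finset.mem_Iic, Finset.mem_univ, iff_true, Fin.le_def]
      have := i.2; omega
    rw [this, S.α_sum]
    rcases x.2.2.lt_or_eq with h | h
    · exact Or.inl h
    · exact Or.inr ⟨hlast, h⟩
  · left
    by_contra hcon
    have hk1 : (k : ℕ) + 1 < n := lt_of_le_of_ne k.2 hlast
    have heq : Finset.Iio (⟨k + 1, hk1⟩ : Fin n) = Finset.Iic k := by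
      ext i
      simp only [Finset.mem_Iio, Finset.mem_Iic, Fin.lt_def, Fin.le_def]
      omega
    have hmem : (⟨k + 1, hk1⟩ : Fin n) ∈ T := by
      refine Finset.mem_filter.2 ⟨Finset.mem_univ _, ?_⟩
      rw [heq]
      exact not_lt.1 hcon
    have := T.le_max' _ hmem
    have : (k : ℕ) + 1 ≤ k := this
    omega

/-- The index of the interval that contains a given point. -/
noncomputable def idx (x : unitInterval) : Fin n := (S.exists_mem_interval x).choose

lemma mem_interval_iff (x : unitInterval) (k : Fin n) : x ∈ S.interval k ↔ S.idx x = k :=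
  ⟨fun h => S.interval_disjoint (S.exists_mem_interval x).choose_spec h,
    fun h => h ▸ (S.exists_mem_interval x).choose_spec⟩

lemma measurableSet_interval (k : Fin n) : MeasurableSet (S.interval k) := by
  have h1 : MeasurableSet {x : unitInterval | ∑ i ∈ Finset.Iio k, S.α i ≤ (x : ℝ)} :=
    measurableSet_le measurable_const measurable_subtype_coe
  have h2 : MeasurableSet {x : unitInterval | (x : ℝ) < ∑ i ∈ Finset.Iic k, S.α i} :=
    measurableSet_lt measurable_subtype_coe measurable_const
  have h3 : MeasurableSet {x : unitInterval | (k : ℕ) + 1 = n ∧ (x : ℝ) = 1} :=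
    (MeasurableSet.const _).inter
      (measurableSet_eq_fun measurable_subtype_coe measurable_const)
  exact h1.inter (h2.union h3)

lemma preimage_idx (k : Fin n) : S.idx ⁻¹' {k} = S.interval k := by
  ext x
  simp [mem_interval_iff]

lemma measurable_idx : Measurable S.idx :=
  measurable_to_countable' fun k => by
    rw [S.preimage_idx]; exact S.measurableSet_interval k

lemma profile_eq (x y : unitInterval) : S.profile x y = S.σ (S.idx x) (S.idx y) := by
  unfold profile
  simp only [mem_interval_iff]
  rw [Finset.sum_eq_single (S.idx x), Finset.sum_eq_single (S.idx y)] <;> simp +contextual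
  · intro b hb h
    exact absurd h.symm hb
  · intro b hb
    exact Finset.sum_eq_zero fun l _ => if_neg fun h => hb h.1.symm

lemma integral_idx (μ : Measure unitInterval) [IsFiniteMeasure μ] (f : Fin n → ℝ) :
    ∫ x, f (S.idx x) ∂μ = ∑ k, μ.real (S.interval k) * f k := by
  rw [← integral_map S.measurable_idx.aemeasurable (f := f)
    (measurable_of_finite f).aestronglyMeasurable, integral_fintype Integrable.of_finite]
  refine Finset.sum_congr rfl fun k _ => ?_
  rw [map_measureReal_apply S.measurable_idx (measurableSet_singleton k), preimage_idx, smul_eq_mul]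

lemma integrable_idx (μ : Measure unitInterval) [IsFiniteMeasure μ] (f : Fin n → ℝ) :
    Integrable (fun x => f (S.idx x)) μ :=
  (integrable_map_measure (measurable_of_finite f).aestronglyMeasurable
    S.measurable_idx.aemeasurable).1 Integrable.of_finite

/-- The interval lies between a half-open and a closed interval with the same endpoints, which also
takes care of the extra point `1`. -/
lemma volume_interval (k : Fin n) :
    (volume : Measure unitInterval).real (S.interval k) = S.α k := by
  have hc : ∑ i ∈ Finset.Iic k, S.α i = ∑ i ∈ Finset.Iio k, S.α i + S.α k := by
    rw [← Finset.Iio_insert, Finset.sum_insert (by simp), add_comm]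
  have h0 : 0 ≤ ∑ i ∈ Finset.Iio k, S.α i := Finset.sum_nonneg fun i _ => (S.α_pos i).le
  have h1 : ∑ i ∈ Finset.Iic k, S.α i ≤ 1 := by
    rw [← S.α_sum]
    exact Finset.sum_le_sum_of_subset_of_nonneg (Finset.subset_univ _) fun i _ _ => (S.α_pos i).le
  have hp := S.α_pos k
  set A : unitInterval := ⟨∑ i ∈ Finset.Iio k, S.α i, h0, by linarith⟩ with hA
  set B : unitInterval := ⟨∑ i ∈ Finset.Iic k, S.α i, by linarith, h1⟩ with hB
  have hAB : (B : ℝ) - A = S.α k := by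
    change ∑ i ∈ Finset.Iic k, S.α i - ∑ i ∈ Finset.Iio k, S.α i = _
    rw [hc]; ring
  have s1 : Set.Ico A B ⊆ S.interval k := fun x hx => ⟨hx.1, Or.inl hx.2⟩
  have s2 : S.interval k ⊆ Set.Icc A B := by
    intro x hx
    refine ⟨hx.1, ?_⟩
    change (x : ℝ) ≤ ∑ i ∈ Finset.Iic k, S.α i
    rcases hx.2 with h | ⟨h, h'⟩
    · exact h.le
    · have : Finset.Iic k = Finset.univ := by
        ext i
        simp only [Finset.mem_Iic, Finset.mem_univ, iff_true, Fin.le_def]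
        have := i.2; omega
      rw [this, S.α_sum]
      exact x.2.2
  have e : volume (S.interval k) = ENNReal.ofReal (S.α k) := by
    refine le_antisymm ((measure_mono s2).trans_eq ?_) ((measure_mono s1).trans_eq' ?_)
    · rw [unitInterval.volume_Icc, hAB]
    · rw [unitInterval.volume_Ico, hAB]
  rw [Measure.real, e, ENNReal.toReal_ofReal hp.le]

/-- The real-valued version of the functional `vecPsi` on positive vectors. -/
noncomputable def gain (β θ : ℝ) (ψ : Fin n → ℝ) : ℝ :=
  θ ^ 2 / β * ∑ k, ∑ l, S.σ k l ^ 2 * ψ k * ψ l +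
    β / 2 * ∑ k, S.α k * (Real.log (ψ k) - Real.log (S.α k))

lemma vecPsi_of_pos (β θ : ℝ) {ψ : Fin n → ℝ} (hψ : ∀ k, 0 < ψ k) :
    S.vecPsi β θ ψ = ((S.gain β θ ψ : ℝ) : EReal) := by
  have h : ∀ s : Finset (Fin n), ∑ k ∈ s, ((S.α k : ℝ) : EReal) *
      (ENNReal.log (ENNReal.ofReal (ψ k)) - ((Real.log (S.α k) : ℝ) : EReal)) =
      ((∑ k ∈ s, S.α k * (Real.log (ψ k) - Real.log (S.α k)) : ℝ) : EReal) := by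
    intro s
    induction s using Finset.induction_on with
    | empty => simp
    | insert a s ha ih =>
      rw [Finset.sum_insert ha, Finset.sum_insert ha, ih, ENNReal.log_ofReal_of_pos (hψ a)]
      norm_cast
  rw [vecPsi, h, gain]
  norm_cast

/-- In `EReal` a summand `⊥` absorbs all the others, so one vanishing coordinate decides the value.
-/
lemma vecPsi_of_not_pos {β : ℝ} (hβ : 0 < β) (θ : ℝ) {ψ : Fin n → ℝ} {k : Fin n} (hψ : ψ k ≤ 0) :
    S.vecPsi β θ ψ = ⊥ := by
  rw [vecPsi, ← Finset.add_sum_erase _ (fun k => ((S.α k : ℝ) : EReal) *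
      (ENNReal.log (ENNReal.ofReal (ψ k)) - ((Real.log (S.α k) : ℝ) : EReal))) (Finset.mem_univ k),
    ENNReal.ofReal_of_nonpos hψ, ENNReal.log_zero, EReal.bot_sub,
    EReal.coe_mul_bot_of_pos (S.α_pos k), EReal.bot_add,
    EReal.coe_mul_bot_of_pos (by linarith), EReal.add_bot]

lemma alpha_mem_stdSimplex : S.α ∈ stdSimplex ℝ (Fin n) := ⟨fun k => (S.α_pos k).le, S.α_sum⟩

/-- `gain` cannot be maximized directly on the closed simplex, because `Real.log 0 = 0` gives it
wrong values on the boundary. Its exponential, up to a constant factor, extends continuously to `h`,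
which vanishes on the boundary and is positive at `α`; hence a maximizer of `h` is interior. -/
lemma exists_gain_max {β : ℝ} (hβ : 0 < β) (θ : ℝ) :
    ∃ ψ ∈ stdSimplex ℝ (Fin n), (∀ k, 0 < ψ k) ∧
      ∀ φ ∈ stdSimplex ℝ (Fin n), (∀ k, 0 < φ k) → S.gain β θ φ ≤ S.gain β θ ψ := by
  set h : (Fin n → ℝ) → ℝ := fun ψ => Real.exp (θ ^ 2 / β * ∑ k, ∑ l, S.σ k l ^ 2 * ψ k * ψ l) *
    ∏ k, (ψ k) ^ (β / 2 * S.α k) with hh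
  have hcont : Continuous h := by
    refine Continuous.mul (by fun_prop) (continuous_finsetProd _ fun k _ => ?_)
    exact (Real.continuous_rpow_const
      (mul_nonneg (by linarith) (S.α_pos k).le)).comp (continuous_apply k)
  have hlog : ∀ ψ : Fin n → ℝ, (∀ k, 0 < ψ k) → 0 < h ψ ∧
      Real.log (h ψ) = S.gain β θ ψ + β / 2 * ∑ k, S.α k * Real.log (S.α k) := by
    intro ψ hψ
    have hp : ∀ k, 0 < ψ k ^ (β / 2 * S.α k) := fun k => Real.rpow_pos_of_pos (hψ k) _
    refine ⟨mul_pos (Real.exp_pos _) (Finset.prod_pos fun k _ => hp k), ?_⟩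
    rw [hh]
    dsimp only
    rw [Real.log_mul (Real.exp_pos _).ne' (Finset.prod_pos fun k _ => hp k).ne', Real.log_exp,
      Real.log_prod (fun k _ => (hp k).ne'), gain, add_assoc, ← mul_add, ← Finset.sum_add_distrib,
      Finset.mul_sum (s := Finset.univ) (a := β / 2)]
    congr 1
    refine Finset.sum_congr rfl fun k _ => ?_
    rw [Real.log_rpow (hψ k)]
    ring
  obtain ⟨ψ, hψ, hmax⟩ := (isCompact_stdSimplex ℝ (Fin n)).exists_isMaxOn
    ⟨S.α, S.alpha_mem_stdSimplex⟩ hcont.continuousOn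
  have hpos : ∀ k, 0 < ψ k := by
    intro k
    refine lt_of_le_of_ne (hψ.1 k) fun h0 => ?_
    have h1 := (hlog S.α S.α_pos).1.trans_le (hmax S.alpha_mem_stdSimplex)
    have h2 : h ψ = 0 := by
      rw [hh]
      dsimp only
      rw [Finset.prod_eq_zero (Finset.mem_univ k), mul_zero]
      rw [← h0, Real.zero_rpow]
      exact (mul_pos (by linarith) (S.α_pos k)).ne'
    linarith
  refine ⟨ψ, hψ, hpos, fun φ hφ hφ0 => ?_⟩
  have h1 := hlog φ hφ0
  have h2 := hlog ψ hpos
  have h3 := Real.log_le_log h1.1 (hmax hφ)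
  rw [h1.2, h2.2] at h3
  linarith

lemma integral_profile (μ : Measure unitInterval) [IsFiniteMeasure μ] :
    ∫ x, ∫ y, S.profile x y ^ 2 ∂μ ∂μ =
      ∑ k, ∑ l, S.σ k l ^ 2 * μ.real (S.interval k) * μ.real (S.interval l) := by
  have h : ∀ x, ∫ y, S.profile x y ^ 2 ∂μ =
      ∑ l, μ.real (S.interval l) * S.σ (S.idx x) l ^ 2 := fun x => by
    simp_rw [profile_eq]
    exact S.integral_idx μ fun l => S.σ (S.idx x) l ^ 2
  simp_rw [h]
  rw [S.integral_idx μ fun k => ∑ l, μ.real (S.interval l) * S.σ k l ^ 2]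
  refine Finset.sum_congr rfl fun k _ => ?_
  rw [Finset.mul_sum]
  refine Finset.sum_congr rfl fun l _ => ?_
  ring

lemma sum_interval (μ : Measure unitInterval) [IsProbabilityMeasure μ] :
    ∑ k, μ.real (S.interval k) = 1 := by
  have := S.integral_idx μ fun _ => 1
  simpa using this.symm

open InformationTheory in
/-- The relative entropy decreases when only the masses of the intervals are observed. -/
lemma le_klDiv (μ : Measure unitInterval) [IsProbabilityMeasure μ]
    (hac : (volume : Measure unitInterval) ≪ μ)
    (hint : Integrable (llr (volume : Measure unitInterval) μ) volume) :
    (∀ k, 0 < μ.real (S.interval k)) ∧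
      ∑ k, S.α k * (Real.log (S.α k) - Real.log (μ.real (S.interval k))) ≤
        (klDiv (volume : Measure unitInterval) μ).toReal := by
  have hpos : ∀ k, 0 < μ.real (S.interval k) := by
    intro k
    refine ENNReal.toReal_pos (fun h => ?_) (measure_ne_top _ _)
    have h1 := S.volume_interval k
    rw [Measure.real, hac h] at h1
    exact (S.α_pos k).ne h1
  refine ⟨hpos, ?_⟩
  set c : Fin n → ℝ := fun k => S.α k / μ.real (S.interval k) with hc
  have hc0 : ∀ k, 0 < c k := fun k => div_pos (S.α_pos k) (hpos k)
  set p : unitInterval → ℝ := fun x => ((volume : Measure unitInterval).rnDeriv μ x).toReal with hp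
  rw [toReal_klDiv_eq_integral_klFun hac]
  have hi1 : Integrable (fun x => klFun (p x)) μ := (integrable_klFun_rnDeriv_iff hac).2 hint
  have hi2 : Integrable (fun x => p x * Real.log (c (S.idx x))) μ := by
    have := (integrable_rnDeriv_smul_iff hac (f := fun x => Real.log (c (S.idx x)))).2
      (S.integrable_idx volume fun k => Real.log (c k))
    simpa only [smul_eq_mul] using this
  have hi3 : Integrable (fun x => 1 - c (S.idx x)) μ := S.integrable_idx μ fun k => 1 - c k
  -- The right side is `klFun` and the left side its tangent at `c`, so this is convexity. Equality
  -- holds when the density is `c`, constant on each interval.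
  have hpt : ∀ x, p x * Real.log (c (S.idx x)) + (1 - c (S.idx x)) ≤ klFun (p x) := by
    intro x
    have hcx := hc0 (S.idx x)
    have hpx : 0 ≤ p x := ENNReal.toReal_nonneg
    rw [klFun_apply]
    rcases hpx.eq_or_lt with h | h
    · rw [← h]; simp [hcx.le]
    · have h1 := Real.log_le_sub_one_of_pos (div_pos hcx h)
      rw [Real.log_div hcx.ne' h.ne'] at h1
      have h2 := mul_le_mul_of_nonneg_left h1 h.le
      have h3 : p x * (c (S.idx x) / p x - 1) = c (S.idx x) - p x := by field_simp
      rw [h3] at h2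
      linarith
  have h1 := integral_mono (hi2.add hi3) hi1 hpt
  simp only [Pi.add_apply] at h1
  rw [integral_add hi2 hi3, S.integral_idx μ fun k => 1 - c k] at h1
  have h2 : ∫ x, p x * Real.log (c (S.idx x)) ∂μ = ∑ k, S.α k * Real.log (c k) := by
    have := integral_rnDeriv_smul hac (f := fun x => Real.log (c (S.idx x)))
    simp only [smul_eq_mul] at this
    rw [this, S.integral_idx volume fun k => Real.log (c k)]
    simp_rw [S.volume_interval]
  have h3 : ∑ k, μ.real (S.interval k) * (1 - c k) = 0 := by
    have : ∀ k, μ.real (S.interval k) * (1 - c k) = μ.real (S.interval k) - S.α k := fun k => by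
      have := (hpos k).ne'
      simp only [hc]
      field_simp
    simp_rw [this]
    rw [Finset.sum_sub_distrib, S.sum_interval, S.α_sum, sub_self]
  rw [h2, h3, add_zero] at h1
  refine le_trans (le_of_eq ?_) h1
  refine Finset.sum_congr rfl fun k _ => ?_
  rw [hc, Real.log_div (S.α_pos k).ne' (hpos k).ne']

open InformationTheory in
/-- A probability measure with given masses of the intervals and the least relative entropy. -/
lemma exists_measure {ψ : Fin n → ℝ} (hψ : ψ ∈ stdSimplex ℝ (Fin n)) (hpos : ∀ k, 0 < ψ k) :
    ∃ μ : Measure unitInterval, IsProbabilityMeasure μ ∧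
      (∀ k, μ.real (S.interval k) = ψ k) ∧ klDiv (volume : Measure unitInterval) μ ≠ ⊤ ∧
      (klDiv (volume : Measure unitInterval) μ).toReal =
        ∑ k, S.α k * (Real.log (S.α k) - Real.log (ψ k)) := by
  -- A density constant on each interval turns the tangent inequality of `le_klDiv` into an
  -- equality.
  set f : unitInterval → ENNReal := fun x => ENNReal.ofReal (ψ (S.idx x) / S.α (S.idx x)) with hf
  have hd : ∀ k, 0 < ψ k / S.α k := fun k => div_pos (hpos k) (S.α_pos k)
  have hfm : Measurable f :=
    (measurable_of_finite fun k : Fin n => ENNReal.ofReal (ψ k / S.α k)).comp S.measurable_idx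
  set μ : Measure unitInterval := volume.withDensity f with hμ
  have hmass : ∀ k, μ (S.interval k) = ENNReal.ofReal (ψ k) := by
    intro k
    rw [hμ, withDensity_apply _ (S.measurableSet_interval k),
      setLIntegral_congr_fun (g := fun _ => ENNReal.ofReal (ψ k / S.α k))
        (S.measurableSet_interval k), setLIntegral_const,
      ← ENNReal.ofReal_toReal (measure_ne_top volume (S.interval k))]
    · change _ * ENNReal.ofReal (volume.real (S.interval k)) = _
      rw [S.volume_interval, ← ENNReal.ofReal_mul (hd k).le, div_mul_cancel₀ _ (S.α_pos k).ne']
    · intro x hx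
      simp only [hf]
      rw [(S.mem_interval_iff x k).1 hx]
  have huniv : μ Set.univ = 1 := by
    have : (Set.univ : Set unitInterval) = ⋃ k, S.interval k := by
      ext x
      simpa using S.exists_mem_interval x
    rw [this, measure_iUnion _ S.measurableSet_interval, tsum_fintype]
    · simp_rw [hmass]
      rw [← ENNReal.ofReal_sum_of_nonneg fun k _ => hψ.1 k, hψ.2, ENNReal.ofReal_one]
    · intro k l hkl
      rw [Function.onFun, Set.disjoint_left]
      exact fun x hk hl => hkl (S.interval_disjoint hk hl)
  have hprob : IsProbabilityMeasure μ := ⟨huniv⟩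
  have hac : (volume : Measure unitInterval) ≪ μ := by
    refine withDensity_absolutelyContinuous' hfm.aemeasurable (Eventually.of_forall fun x => ?_)
    simp only [hf, ne_eq, ENNReal.ofReal_eq_zero, not_le]
    exact hd _
  have hac' : μ ≪ (volume : Measure unitInterval) := withDensity_absolutelyContinuous _ _
  have hllr : llr (volume : Measure unitInterval) μ =ᵐ[volume]
      fun x => Real.log (S.α (S.idx x)) - Real.log (ψ (S.idx x)) := by
    have h1 := neg_llr hac'
    have h2 := Measure.rnDeriv_withDensity (volume : Measure unitInterval) hfm
    filter_upwards [hac.ae_le h1, h2] with x hx hx2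
    rw [← hx, Pi.neg_apply, llr, hμ, hx2, hf]
    dsimp only
    rw [ENNReal.toReal_ofReal (hd _).le, Real.log_div (hpos _).ne' (S.α_pos _).ne']
    ring
  have hint : Integrable (llr (volume : Measure unitInterval) μ) volume :=
    (S.integrable_idx volume fun k => Real.log (S.α k) - Real.log (ψ k)).congr hllr.symm
  refine ⟨μ, hprob, fun k => ?_, klDiv_ne_top hac hint, ?_⟩
  · rw [Measure.real, hmass, ENNReal.toReal_ofReal (hpos k).le]
  · rw [toReal_klDiv_of_measure_eq hac (by simp [huniv]), integral_congr_ae hllr,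
      S.integral_idx volume fun k => Real.log (S.α k) - Real.log (ψ k)]
    simp_rw [S.volume_interval]

-- The integral term sees only the masses of the intervals, so for given masses the divergence
-- should be as small as possible. Measures of infinite divergence contribute `⊥`.
open InformationTheory in
lemma limitF_eq {β θ : ℝ} (hβ : 0 < β) {ψ : Fin n → ℝ} (hψ : ψ ∈ stdSimplex ℝ (Fin n))
    (hpos : ∀ k, 0 < ψ k)
    (hmax : ∀ φ ∈ stdSimplex ℝ (Fin n), (∀ k, 0 < φ k) → S.gain β θ φ ≤ S.gain β θ ψ) :
    limitF β θ S.profile = ((S.gain β θ ψ : ℝ) : EReal) := by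
  have key : ∀ (μ : Measure unitInterval) [IsProbabilityMeasure μ],
      klDiv (volume : Measure unitInterval) μ ≠ ⊤ →
      ((θ ^ 2 / β * ∫ x, ∫ y, S.profile x y ^ 2 ∂μ ∂μ : ℝ) : EReal) - ((β / 2 : ℝ) : EReal) *
        ((klDiv (volume : Measure unitInterval) μ : ENNReal) : EReal) =
      ((θ ^ 2 / β * (∑ k, ∑ l, S.σ k l ^ 2 * μ.real (S.interval k) * μ.real (S.interval l)) -
        β / 2 * (klDiv (volume : Measure unitInterval) μ).toReal : ℝ) : EReal) := by
    intro μ _ h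
    rw [S.integral_profile, ← EReal.coe_toReal (x := ((klDiv (volume : Measure unitInterval) μ :
      ENNReal) : EReal)) (by simpa using h) (by simp), EReal.toReal_coe_ennreal]
    norm_cast
  refine le_antisymm (iSup_le fun μ => ?_) ?_
  · by_cases h : klDiv (volume : Measure unitInterval) (μ : Measure unitInterval) = ⊤
    · rw [h, EReal.coe_ennreal_top, EReal.coe_mul_top_of_pos (by linarith), EReal.sub_top]
      exact bot_le
    · obtain ⟨hac, hint⟩ := klDiv_ne_top_iff.1 h
      obtain ⟨hp, hle⟩ := S.le_klDiv (μ : Measure unitInterval) hac hint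
      rw [key _ h, EReal.coe_le_coe_iff]
      refine le_trans ?_ (hmax (fun k => (μ : Measure unitInterval).real (S.interval k))
        ⟨fun k => (hp k).le, S.sum_interval _⟩ hp)
      rw [gain, sub_eq_add_neg]
      gcongr
      rw [← mul_neg]
      gcongr
      rw [neg_le, ← Finset.sum_neg_distrib]
      refine le_trans (le_of_eq (Finset.sum_congr rfl fun k _ => ?_)) hle
      ring
  · obtain ⟨μ, hprob, hmass, htop, hkl⟩ := S.exists_measure hψ hpos
    refine le_iSup_of_le ⟨μ, hprob⟩ ?_
    simp only [ProbabilityMeasure.coe_mk]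
    rw [key μ htop, EReal.coe_le_coe_iff, hkl, gain, sub_eq_add_neg, ← mul_neg,
      ← Finset.sum_neg_distrib]
    simp_rw [hmass]
    gcongr
    refine le_of_eq ?_
    ring

lemma isGreatest_limitF {β : ℝ} (hβ : 0 < β) (θ : ℝ) :
    IsGreatest (S.vecPsi β θ '' stdSimplex ℝ (Fin n)) (limitF β θ S.profile) := by
  obtain ⟨ψ, hψ, hpos, hmax⟩ := S.exists_gain_max hβ θ
  rw [S.limitF_eq hβ hψ hpos hmax]
  refine ⟨⟨ψ, hψ, S.vecPsi_of_pos β θ hpos⟩, ?_⟩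
  rintro _ ⟨φ, hφ, rfl⟩
  by_cases h : ∀ k, 0 < φ k
  · rw [S.vecPsi_of_pos β θ h]
    exact EReal.coe_le_coe_iff.2 (hmax φ hφ h)
  · push Not at h
    obtain ⟨k, hk⟩ := h
    rw [S.vecPsi_of_not_pos hβ θ hk]
    exact bot_le

end PiecewiseProfile

/-! ### The blocks of indices and their relative sizes. -/

namespace PiecewiseProfile

variable {n : ℕ} (S : PiecewiseProfile n)

section Blocks

lemma block_disjoint {N : ℕ} {k l : Fin n} {i : Fin N} (hk : i ∈ S.block N k)
    (hl : i ∈ S.block N l) : k = l := by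
  have aux : ∀ {k l : Fin n}, i ∈ S.block N k → i ∈ S.block N l → ¬k < l := by
    intro k l hk hl h
    simp only [block, Finset.mem_filter, Finset.mem_univ, true_and] at hk hl
    have : S.bd N k.succ ≤ S.bd N l.castSucc := S.bd_mono N (by
      rw [Fin.le_def]; simpa using Nat.succ_le_of_lt h)
    omega
  rcases lt_trichotomy k l with h | h | h
  · exact absurd h (aux hk hl)
  · exact h
  · exact absurd h (aux hl hk)

lemma exists_mem_block {N : ℕ} (i : Fin N) : ∃ k, i ∈ S.block N k := by
  have hn := S.nat_pos
  set T : Finset (Fin n) := Finset.univ.filter fun k => S.bd N k.castSucc ≤ (i : ℕ)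
  have hT : T.Nonempty := by
    refine ⟨⟨0, hn⟩, Finset.mem_filter.2 ⟨Finset.mem_univ _, ?_⟩⟩
    have : (⟨0, hn⟩ : Fin n).castSucc = 0 := by ext; simp
    rw [this, S.bd_zero]
    exact Nat.zero_le _
  set k := T.max' hT
  have hk := T.max'_mem hT
  refine ⟨k, Finset.mem_filter.2 ⟨Finset.mem_univ _, (Finset.mem_filter.1 hk).2, ?_⟩⟩
  by_cases hlast : (k : ℕ) + 1 = n
  · have : k.succ = Fin.last n := by ext; simpa using hlast
    rw [this, S.bd_last]
    exact i.2
  · by_contra hcon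
    have hk1 : (k : ℕ) + 1 < n := lt_of_le_of_ne k.2 hlast
    have heq : (⟨k + 1, hk1⟩ : Fin n).castSucc = k.succ := by ext; simp
    have hmem : (⟨k + 1, hk1⟩ : Fin n) ∈ T := by
      refine Finset.mem_filter.2 ⟨Finset.mem_univ _, ?_⟩
      rw [heq]
      exact not_lt.1 hcon
    have := T.le_max' _ hmem
    have : (k : ℕ) + 1 ≤ k := this
    omega

/-- The index of the block that contains a given index. -/
noncomputable def blockIdx (N : ℕ) (i : Fin N) : Fin n := (S.exists_mem_block i).choose

lemma mem_block_iff {N : ℕ} (i : Fin N) (k : Fin n) : i ∈ S.block N k ↔ S.blockIdx N i = k :=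
  ⟨fun h => S.block_disjoint (S.exists_mem_block i).choose_spec h,
    fun h => h ▸ (S.exists_mem_block i).choose_spec⟩

lemma profileMatrix_eq {N : ℕ} (i j : Fin N) :
    S.profileMatrix N i j = S.σ (S.blockIdx N i) (S.blockIdx N j) := by
  unfold profileMatrix
  simp only [mem_block_iff]
  rw [Finset.sum_eq_single (S.blockIdx N i), Finset.sum_eq_single (S.blockIdx N j)] <;>
    simp +contextual
  · intro b hb h
    exact absurd h.symm hb
  · intro b hb
    exact Finset.sum_eq_zero fun l _ => if_neg fun h => hb h.1.symm

lemma profileMatrix_isSymm (N : ℕ) : (S.profileMatrix N).IsSymm := by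
  ext i j
  rw [Matrix.transpose_apply, S.profileMatrix_eq, S.profileMatrix_eq, S.σ_symm.apply]

/-- The size of a block. -/
noncomputable def blockCard (N : ℕ) (k : Fin n) : ℕ := Fintype.card {i // S.blockIdx N i = k}

lemma sum_blockCard (N : ℕ) : ∑ k, S.blockCard N k = N := by
  unfold blockCard
  rw [← Fintype.card_sigma, Fintype.card_congr (Equiv.sigmaFiberEquiv (S.blockIdx N)),
    Fintype.card_fin]

lemma blockCard_eq (N : ℕ) (k : Fin n) :
    S.blockCard N k = S.bd N k.succ - S.bd N k.castSucc := by
  have h1 : S.blockCard N k = (S.block N k).card := by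
    rw [blockCard, Fintype.card_subtype]
    congr 1
    ext i
    simp [mem_block_iff]
  have hle : S.bd N k.succ ≤ N := by
    have := S.bd_mono N (Fin.le_last k.succ)
    rwa [S.bd_last] at this
  rw [h1, ← Nat.card_Ico, ← Finset.card_map Fin.valEmbedding]
  congr 1
  ext i
  simp only [block, Finset.mem_map, Finset.mem_filter, Finset.mem_univ, true_and,
    Fin.valEmbedding_apply, Finset.mem_Ico]
  constructor
  · rintro ⟨j, h, rfl⟩
    exact h
  · intro h
    exact ⟨⟨i, h.2.trans_le hle⟩, h, rfl⟩

/-- The relative size of a block. -/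
noncomputable def blockFreq (N : ℕ) (k : Fin n) : ℝ := S.blockCard N k / N

lemma tendsto_blockFreq (k : Fin n) :
    Tendsto (fun N => S.blockFreq N k) atTop (𝓝 (S.α k)) := by
  refine (S.bd_tendsto k).congr fun N => ?_
  rw [blockFreq, blockCard_eq, Nat.cast_sub]
  exact S.bd_mono N (Fin.castSucc_lt_succ).le

lemma eventually_blockFreq_pos : ∀ᶠ N in atTop, ∀ k, 0 < S.blockFreq N k :=
  eventually_all.2 fun k => (S.tendsto_blockFreq k).eventually (lt_mem_nhds (S.α_pos k))

lemma sum_blockFreq {N : ℕ} (hN : 0 < N) : ∑ k, S.blockFreq N k = 1 := by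
  unfold blockFreq
  rw [← Finset.sum_div, ← Nat.cast_sum, S.sum_blockCard, div_self]
  exact_mod_cast hN.ne'

lemma blockFreq_mul {N : ℕ} (hN : 0 < N) (k : Fin n) :
    N * S.blockFreq N k = S.blockCard N k := by
  rw [blockFreq, mul_div_cancel₀]
  exact_mod_cast hN.ne'

lemma prod_rpow_blockCard {N : ℕ} (hN : 0 < N) (β : ℝ) {t : Fin n → ℝ} (ht : ∀ k, 0 < t k) :
    ∏ k, t k ^ (β * S.blockCard N k / 2) =
      Real.exp (N * (β / 2 * ∑ k, S.blockFreq N k * Real.log (t k))) := by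
  rw [Finset.mul_sum, Finset.mul_sum, Real.exp_sum]
  refine Finset.prod_congr rfl fun k _ => ?_
  rw [Real.rpow_def_of_pos (ht k), ← S.blockFreq_mul hN]
  congr 1; ring

end Blocks

/-! ### The volume ratio at exponential scale. -/

section VolumeRatio

variable (𝕜 : Type*) [RCLike 𝕜]

/-- The ratio between the volume of the product of the unit balls of the blocks and the volume of
the unit ball. -/
noncomputable def volRatio (N : ℕ) : ℝ :=
  (∏ k, ballVol 𝕜 {i // S.blockIdx N i = k}) / ballVol 𝕜 (Fin N)

/-- The product of balls of squared radii `blockFreq N k`, whose sum is one, fits in the unit ball.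
By Gibbs' inequality these radii are the best choice, so the bound is sharp at exponential scale. -/
lemma volRatio_le {N : ℕ} (hN : 0 < N) (hp : ∀ k, 0 < S.blockFreq N k) :
    S.volRatio 𝕜 N ≤ Real.exp (-(N * (dysonIndex 𝕜 / 2 *
      ∑ k, S.blockFreq N k * Real.log (S.blockFreq N k)))) := by
  have h := prod_ballVol_le (𝕜 := 𝕜) (S.blockIdx N) hp (S.sum_blockFreq hN).le
  rw [Finset.prod_mul_distrib] at h
  have h2 := S.prod_rpow_blockCard hN (dysonIndex 𝕜) hp
  unfold blockCard at h2
  rw [h2] at h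
  rw [volRatio, div_le_iff₀ ballVol_pos, Real.exp_neg, ← div_eq_inv_mul,
    le_div_iff₀ (Real.exp_pos _), mul_comm]
  exact h

/-- Gibbs' inequality. -/
lemma sum_mul_log_le {p t : Fin n → ℝ} (hp : ∀ k, 0 < p k) (hp1 : ∑ k, p k = 1)
    (ht : ∀ k, 0 < t k) :
    ∑ k, p k * Real.log (t k) ≤ ∑ k, p k * Real.log (p k) + (∑ k, t k - 1) := by
  rw [← hp1, ← Finset.sum_sub_distrib, ← Finset.sum_add_distrib]
  refine Finset.sum_le_sum fun k _ => ?_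
  have h := Real.log_le_sub_one_of_pos (div_pos (ht k) (hp k))
  rw [Real.log_div (ht k).ne' (hp k).ne'] at h
  have h2 := mul_le_mul_of_nonneg_left h (hp k).le
  have h3 : p k * (t k / p k - 1) = t k - p k := by
    have := (hp k).ne'
    field_simp
  rw [h3] at h2
  linarith

/-- The point of the grid with a given multi-index. -/
noncomputable def gridPoint (M : ℕ) (j : Fin n → Fin (M + 1)) (k : Fin n) : ℝ :=
  ((j k : ℕ) + 1 : ℝ) / M

lemma gridPoint_pos {M : ℕ} (hM : 0 < M) (j : Fin n → Fin (M + 1)) (k : Fin n) :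
    0 < gridPoint M j k := by
  have : (0 : ℝ) < M := by exact_mod_cast hM
  unfold gridPoint; positivity

lemma sum_gridPoint_le {M : ℕ} (hM : 0 < M) {j : Fin n → Fin (M + 1)}
    (hj : j ∈ simplexGrid (Fin n) M) : ∑ k, gridPoint M j k ≤ 1 + n / M := by
  have hM' : (0 : ℝ) < M := by exact_mod_cast hM
  have h1 := (Finset.mem_filter.1 hj).2
  have h2 : (∑ k, ((j k : ℕ) : ℝ)) ≤ M := by exact_mod_cast h1
  unfold gridPoint
  rw [← Finset.sum_div, Finset.sum_add_distrib, div_le_iff₀ hM', add_mul, div_mul_cancel₀ _ hM'.ne']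
  simp only [Finset.sum_const, Finset.card_univ, Fintype.card_fin, nsmul_eq_mul, mul_one]
  linarith

/-- The ball is covered by the products of balls of the grid. Gibbs' inequality bounds each of them
by the optimal product, with an error `n / M` because a grid point may have sum `1 + n / M`; the
number of pieces does not depend on `N`. -/
lemma le_volRatio {N M : ℕ} (hN : 0 < N) (hM : 0 < M) (hp : ∀ k, 0 < S.blockFreq N k) :
    Real.exp (-(N * (dysonIndex 𝕜 / 2 *
      (∑ k, S.blockFreq N k * Real.log (S.blockFreq N k) + n / M)))) ≤
      (simplexGrid (Fin n) M).card * S.volRatio 𝕜 N := by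
  have hβ := dysonIndex_pos (𝕜 := 𝕜)
  have h := ballVol_le_sum (𝕜 := 𝕜) (S.blockIdx N) hM
  set E := Real.exp (N * (dysonIndex 𝕜 / 2 *
      (∑ k, S.blockFreq N k * Real.log (S.blockFreq N k) + n / M))) with hE
  have hV : (0 : ℝ) ≤ ∏ k, ballVol 𝕜 {i // S.blockIdx N i = k} :=
    Finset.prod_nonneg fun _ _ => ballVol_pos.le
  have h1 : ballVol 𝕜 (Fin N) ≤ ∑ j ∈ simplexGrid (Fin n) M,
      E * ∏ k, ballVol 𝕜 {i // S.blockIdx N i = k} := by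
    refine h.trans (Finset.sum_le_sum fun j hj => ?_)
    rw [Finset.prod_mul_distrib]
    refine mul_le_mul_of_nonneg_right ?_ hV
    have h2 := S.prod_rpow_blockCard hN (dysonIndex 𝕜) (gridPoint_pos hM j)
    unfold blockCard gridPoint at h2
    rw [h2, hE, Real.exp_le_exp]
    have h3 := sum_mul_log_le hp (S.sum_blockFreq hN) (gridPoint_pos hM j)
    have h4 := sum_gridPoint_le hM hj
    unfold gridPoint at h3 h4
    gcongr
    linarith
  rw [Finset.sum_const, nsmul_eq_mul] at h1
  rw [volRatio, Real.exp_neg, ← mul_div_assoc, le_div_iff₀ ballVol_pos,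
    inv_mul_le_iff₀ (Real.exp_pos _)]
  rw [← hE]
  linarith

end VolumeRatio

/-! ### Block masses of unit vectors. -/

section Sphere

variable {𝕜 : Type*} [RCLike 𝕜]

/-- The mass of a unit vector in a block. -/
noncomputable def blockMass {N : ℕ} (e : USphere 𝕜 N) (k : Fin n) : ℝ :=
  sqSum fun i : {i // S.blockIdx N i = k} => e.1 i

lemma blockMass_eq {N : ℕ} (e : USphere 𝕜 N) (k : Fin n) :
    S.blockMass e k = ∑ m ∈ S.block N k, ‖e.1 m‖ ^ 2 := by
  rw [blockMass, sqSum, Finset.sum_subtype (p := fun i => S.blockIdx N i = k)]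
  simp [mem_block_iff]

lemma blockMass_nonneg {N : ℕ} (e : USphere 𝕜 N) (k : Fin n) : 0 ≤ S.blockMass e k :=
  sqSum_nonneg _

lemma sum_blockMass {N : ℕ} (e : USphere 𝕜 N) : ∑ k, S.blockMass e k = 1 := by
  unfold blockMass
  rw [← sqSum_eq_sum_fiber (S.blockIdx N) e.1.ofLp, ← norm_sq_eq_sqSum,
    mem_sphere_zero_iff_norm.1 e.2, one_pow]

lemma blockMass_le_one {N : ℕ} (e : USphere 𝕜 N) (k : Fin n) : S.blockMass e k ≤ 1 := by
  rw [← S.sum_blockMass e]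
  exact Finset.single_le_sum (fun k _ => S.blockMass_nonneg e k) (Finset.mem_univ k)

lemma continuous_blockMass {N : ℕ} (k : Fin n) :
    Continuous fun e : USphere 𝕜 N => S.blockMass e k := by
  refine continuous_sqSum.comp (continuous_pi fun i => ?_)
  fun_prop

/-- The quadratic form `∑ σ_{kl}² ψ_k ψ_l`. -/
def energy (ψ : Fin n → ℝ) : ℝ := ∑ k, ∑ l, S.σ k l ^ 2 * ψ k * ψ l

lemma energy_mono {φ ψ : Fin n → ℝ} (h0 : ∀ k, 0 ≤ φ k) (h : ∀ k, φ k ≤ ψ k) :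
    S.energy φ ≤ S.energy ψ := by
  unfold energy
  refine Finset.sum_le_sum fun k _ => Finset.sum_le_sum fun l _ => ?_
  have := h0 k
  have := h0 l
  exact mul_le_mul (mul_le_mul_of_nonneg_left (h k) (sq_nonneg _)) (h l) (h0 l)
    (mul_nonneg (sq_nonneg _) ((h0 k).trans (h k)))

lemma energy_smul (c : ℝ) (ψ : Fin n → ℝ) : (S.energy fun k => c * ψ k) = c ^ 2 * S.energy ψ := by
  simp only [energy, Finset.mul_sum]
  refine Finset.sum_congr rfl fun k _ => Finset.sum_congr rfl fun l _ => ?_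
  ring

lemma energy_nonneg {ψ : Fin n → ℝ} (h : ∀ k, 0 ≤ ψ k) : 0 ≤ S.energy ψ := by
  unfold energy
  refine Finset.sum_nonneg fun k _ => Finset.sum_nonneg fun l _ => ?_
  have := h k
  have := h l
  positivity

/-- This is where the dimension drops from `N` to `n`: the averaged exponent depends on `e` only
through its block masses. -/
lemma sum_profileMatrix_eq {N : ℕ} (e : USphere 𝕜 N) :
    ∑ i, ∑ j, S.profileMatrix N i j ^ 2 * ‖e.1 i‖ ^ 2 * ‖e.1 j‖ ^ 2 = S.energy (S.blockMass e) := by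
  have key : ∀ g : Fin N → Fin n → ℝ, ∑ i, g i (S.blockIdx N i) * ‖e.1 i‖ ^ 2 =
      ∑ k, ∑ m ∈ S.block N k, g m k * ‖e.1 m‖ ^ 2 := by
    intro g
    rw [← Finset.sum_fiberwise_of_maps_to (g := S.blockIdx N) (t := Finset.univ)
      (fun _ _ => Finset.mem_univ _)]
    refine Finset.sum_congr rfl fun k _ => Finset.sum_congr ?_ fun i hi => ?_
    · ext i; simp [mem_block_iff]
    · rw [(S.mem_block_iff i k).1 hi]
  simp_rw [S.profileMatrix_eq]
  have h1 : ∀ i, ∑ j, S.σ (S.blockIdx N i) (S.blockIdx N j) ^ 2 * ‖e.1 i‖ ^ 2 * ‖e.1 j‖ ^ 2 =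
      (∑ l, S.σ (S.blockIdx N i) l ^ 2 * S.blockMass e l) * ‖e.1 i‖ ^ 2 := by
    intro i
    rw [key fun _ l => S.σ (S.blockIdx N i) l ^ 2 * ‖e.1 i‖ ^ 2, Finset.sum_mul]
    refine Finset.sum_congr rfl fun l _ => ?_
    rw [S.blockMass_eq, ← Finset.mul_sum]
    ring
  simp_rw [h1]
  rw [key fun _ k => ∑ l, S.σ k l ^ 2 * S.blockMass e l, energy]
  refine Finset.sum_congr rfl fun k _ => ?_
  rw [← Finset.mul_sum, ← S.blockMass_eq, Finset.sum_mul]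
  refine Finset.sum_congr rfl fun l _ => ?_
  ring

/-- Shrinking a vector decreases its block masses, so the cone over this set stays in a product of
balls. -/
lemma uniformSphere_blockMass_le {N : ℕ} (hN : 0 < N) {t : Fin n → ℝ} (ht : ∀ k, 0 < t k) :
    (uniformSphere 𝕜 N).real {e | ∀ k, S.blockMass e k ≤ t k} ≤
      S.volRatio 𝕜 N * ∏ k, t k ^ (dysonIndex 𝕜 * S.blockCard N k / 2) := by
  have hA : MeasurableSet {e : USphere 𝕜 N | ∀ k, S.blockMass e k ≤ t k} := by
    rw [Set.ofPred_forall]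
    exact MeasurableSet.iInter fun k =>
      (isClosed_le (S.continuous_blockMass k) continuous_const).measurableSet
  refine (uniformSphere_le hN hA (B := {x : Fin N → 𝕜 |
    ∀ k, sqSum (fun i : {i // S.blockIdx N i = k} => x i) ≤ t k}) ?_ ?_).trans_eq ?_
  · refine ((measure_mono ?_).trans_lt
      (haarPi_sqSum_le_lt_top (𝕜 := 𝕜) (ι := Fin N) (∑ k, t k))).ne
    intro x hx
    rw [Set.mem_ofPred_eq, sqSum_eq_sum_fiber (S.blockIdx N)]
    exact Finset.sum_le_sum fun k _ => hx k
  · intro e he r h0 h1 k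
    have := sqSum_smul r fun i : {i // S.blockIdx N i = k} => e.1.ofLp i
    refine (this.trans_le ?_).trans (he k)
    have h2 := S.blockMass_nonneg e k
    unfold blockMass at h2 ⊢
    have h3 : r ^ 2 ≤ 1 := by nlinarith
    exact mul_le_of_le_one_left h2 h3
  · rw [haarPi_real_blocks_sqSum_le _ ht, Finset.prod_mul_distrib, volRatio]
    unfold blockCard
    ring

end Sphere

end PiecewiseProfile

/-! ### From exponential bounds to limits, and exchange of the two expectations. -/

lemma inv_mul_log_exp {N : ℕ} (hN : 0 < N) (x : ℝ) :
    (((N : ℝ)⁻¹ : ℝ) : EReal) * ENNReal.log (ENNReal.ofReal (Real.exp (N * x))) = (x : EReal) := by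
  rw [ENNReal.log_ofReal_of_pos (Real.exp_pos _), Real.log_exp, ← EReal.coe_mul,
    inv_mul_cancel_left₀]
  exact_mod_cast hN.ne'

/-- Logarithmic asymptotics from exponential bounds. -/
lemma tendsto_inv_mul_log {Z : ℕ → ENNReal} {g : ℝ}
    (hl : ∀ η > 0, ∀ᶠ N : ℕ in atTop, ENNReal.ofReal (Real.exp (N * (g - η))) ≤ Z N)
    (hu : ∀ η > 0, ∀ᶠ N : ℕ in atTop, Z N ≤ ENNReal.ofReal (Real.exp (N * (g + η)))) :
    Tendsto (fun N : ℕ => (((N : ℝ)⁻¹ : ℝ) : EReal) * ENNReal.log (Z N)) atTop (𝓝 (g : EReal)) := by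
  have hinv : ∀ N : ℕ, (0 : EReal) ≤ (((N : ℝ)⁻¹ : ℝ) : EReal) := fun N => by
    exact_mod_cast inv_nonneg.2 (Nat.cast_nonneg N)
  refine tendsto_order.2 ⟨fun a ha => ?_, fun b hb => ?_⟩
  · obtain ⟨x, hx1, hx2⟩ := EReal.lt_iff_exists_real_btwn.1 ha
    have hx : 0 < g - x := sub_pos.2 (EReal.coe_lt_coe_iff.1 hx2)
    filter_upwards [hl _ hx, eventually_gt_atTop 0] with N h1 h0
    rw [sub_sub_cancel] at h1
    refine hx1.trans_le ?_
    rw [← inv_mul_log_exp h0 x]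
    exact mul_le_mul_of_nonneg_left (ENNReal.log_monotone h1) (hinv N)
  · obtain ⟨x, hx1, hx2⟩ := EReal.lt_iff_exists_real_btwn.1 hb
    have hx : 0 < x - g := sub_pos.2 (EReal.coe_lt_coe_iff.1 hx1)
    filter_upwards [hu _ hx, eventually_gt_atTop 0] with N h1 h0
    rw [add_sub_cancel] at h1
    refine lt_of_le_of_lt ?_ hx2
    rw [← inv_mul_log_exp h0 x]
    exact mul_le_mul_of_nonneg_left (ENNReal.log_monotone h1) (hinv N)

section Exchange

variable {𝕜 : Type*} [RCLike 𝕜] {Ω : Type*} [MeasurableSpace Ω] {P : Measure Ω} {N : ℕ}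
  {a : Fin N → Fin N → Ω → 𝕜}

lemma measurable_quadForm (ha : IsWignerFamily P a) (A : Matrix (Fin N) (Fin N) ℝ) :
    Measurable fun p : Ω × USphere 𝕜 N =>
      quadForm (modelMatrix A fun i j => a i j p.1) p.2 := by
  have hcoord : ∀ i, Measurable fun p : Ω × USphere 𝕜 N => p.2.1 i := fun i =>
    (by fun_prop : Continuous fun e : USphere 𝕜 N => e.1 i).measurable.comp measurable_snd
  have hentry : ∀ i j, Measurable fun p : Ω × USphere 𝕜 N =>
      modelMatrix A (fun i j => a i j p.1) i j := by
    intro i j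
    simp only [modelMatrix, Matrix.hadamard_apply, wignerMatrix]
    refine Measurable.mul_const (Measurable.div_const ?_ _) _
    by_cases h : i ≤ j
    · simp only [if_pos h]
      exact (ha.measurable i j h).comp measurable_fst
    · simp only [if_neg h]
      exact RCLike.continuous_conj.measurable.comp
        ((ha.measurable j i (not_le.1 h).le).comp measurable_fst)
  unfold quadForm
  refine RCLike.measurable_re.comp (Finset.measurable_sum _ fun i _ =>
    Finset.measurable_sum _ fun j _ => ?_)
  exact ((RCLike.continuous_conj.measurable.comp (hcoord i)).mul (hentry i j)).mul (hcoord j)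

lemma lintegral_swap_exponent [IsProbabilityMeasure P] (hN : 0 < N) (ha : IsWignerFamily P a)
    (A : Matrix (Fin N) (Fin N) ℝ) (θ : ℝ) :
    ∫⁻ ω, ∫⁻ e, ENNReal.ofReal (Real.exp (N * θ * quadForm (modelMatrix A fun i j => a i j ω) e))
      ∂(uniformSphere 𝕜 N) ∂P =
    ∫⁻ e, ∫⁻ ω, ENNReal.ofReal (Real.exp (N * θ * quadForm (modelMatrix A fun i j => a i j ω) e))
      ∂P ∂(uniformSphere 𝕜 N) := by
  have := isProbabilityMeasure_uniformSphere (𝕜 := 𝕜) hN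
  refine lintegral_lintegral_swap (Measurable.aemeasurable ?_)
  exact (((measurable_quadForm ha A).const_mul (N * θ)).exp).ennreal_ofReal

end Exchange

/-! ### The upper bound: Laplace's method on a finite grid. -/

namespace PiecewiseProfile

variable {n : ℕ} (S : PiecewiseProfile n)

/-- The functional with the relative sizes of the blocks in place of the limiting weights. -/
noncomputable def blockGain (β θ : ℝ) (N : ℕ) (t : Fin n → ℝ) : ℝ :=
  θ ^ 2 / β * S.energy t +
    β / 2 * ∑ k, S.blockFreq N k * (Real.log (t k) - Real.log (S.blockFreq N k))

lemma tendsto_entropy (t : Fin n → ℝ) :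
    Tendsto (fun N => ∑ k, S.blockFreq N k * (Real.log (t k) - Real.log (S.blockFreq N k)))
      atTop (𝓝 (∑ k, S.α k * (Real.log (t k) - Real.log (S.α k)))) :=
  tendsto_finsetSum _ fun k _ => (S.tendsto_blockFreq k).mul
    (tendsto_const_nhds.sub ((S.tendsto_blockFreq k).log (S.α_pos k).ne'))

lemma tendsto_blockGain (β θ : ℝ) (t : Fin n → ℝ) :
    Tendsto (fun N => S.blockGain β θ N t) atTop (𝓝 (S.gain β θ t)) :=
  tendsto_const_nhds.add ((S.tendsto_entropy t).const_mul _)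

/-- The functional on a multiple of the simplex. -/
lemma gain_le_of_sum_le {β θ : ℝ} (hβ : 0 < β) {g r : ℝ}
    (hg : ∀ φ ∈ stdSimplex ℝ (Fin n), (∀ k, 0 < φ k) → S.gain β θ φ ≤ g) (hr : 0 ≤ r)
    {t : Fin n → ℝ} (ht : ∀ k, 0 < t k) (hsum : ∑ k, t k ≤ 1 + r) :
    S.gain β θ t ≤ g + ((1 + r) ^ 2 - 1) * (θ ^ 2 / β * S.energy fun _ => 1) + β / 2 * r := by
  have hne : Nonempty (Fin n) := ⟨⟨0, S.nat_pos⟩⟩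
  set s := ∑ k, t k with hs
  have hs0 : 0 < s := Finset.sum_pos (fun k _ => ht k) Finset.univ_nonempty
  -- Normalizing `t` multiplies the energy by `s²` and adds `log s ≤ r` to the entropy term; these
  -- are the two error terms of the statement.
  set φ : Fin n → ℝ := fun k => t k / s with hφ
  have hφ0 : ∀ k, 0 < φ k := fun k => div_pos (ht k) hs0
  have hφ1 : ∑ k, φ k = 1 := by rw [hφ, ← Finset.sum_div, ← hs, div_self hs0.ne']
  have h1 := hg φ ⟨fun k => (hφ0 k).le, hφ1⟩ hφ0
  have hφle : ∀ k, φ k ≤ 1 := fun k => by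
    rw [← hφ1]
    exact Finset.single_le_sum (fun k _ => (hφ0 k).le) (Finset.mem_univ k)
  have htφ : t = fun k => s * φ k := by
    ext k; rw [hφ]; dsimp only; rw [mul_div_cancel₀ _ hs0.ne']
  have hen : S.energy t = s ^ 2 * S.energy φ := by
    conv_lhs => rw [htφ]
    exact S.energy_smul s φ
  have hlog : ∑ k, S.α k * (Real.log (t k) - Real.log (S.α k)) =
      ∑ k, S.α k * (Real.log (φ k) - Real.log (S.α k)) + Real.log s := by
    have : Real.log s = ∑ k, S.α k * Real.log s := by rw [← Finset.sum_mul, S.α_sum, one_mul]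
    rw [this, ← Finset.sum_add_distrib]
    refine Finset.sum_congr rfl fun k _ => ?_
    rw [hφ]
    dsimp only
    rw [Real.log_div (ht k).ne' hs0.ne']
    ring
  have h2 : S.energy φ ≤ S.energy fun _ => 1 := S.energy_mono (fun k => (hφ0 k).le) hφle
  have h3 := S.energy_nonneg fun k => (hφ0 k).le
  have h4 : Real.log s ≤ r := (Real.log_le_sub_one_of_pos hs0).trans (by linarith)
  have hθ : 0 ≤ θ ^ 2 / β := by positivity
  have h5 : s ^ 2 * S.energy φ ≤ S.energy φ + ((1 + r) ^ 2 - 1) * S.energy fun _ => 1 := by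
    have h6 : s ^ 2 ≤ (1 + r) ^ 2 := by gcongr
    have h7 : 0 ≤ (1 + r) ^ 2 - 1 := by nlinarith
    nlinarith [mul_le_mul_of_nonneg_right h6 h3, mul_le_mul_of_nonneg_left h2 h7]
  have h8 := mul_le_mul_of_nonneg_left h5 hθ
  have h9 : β / 2 * Real.log s ≤ β / 2 * r := mul_le_mul_of_nonneg_left h4 (by linarith)
  have e1 : S.gain β θ t = θ ^ 2 / β * (s ^ 2 * S.energy φ) +
      β / 2 * (∑ k, S.α k * (Real.log (φ k) - Real.log (S.α k)) + Real.log s) := by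
    rw [← hen, ← hlog]; rfl
  have e2 : S.gain β θ φ = θ ^ 2 / β * S.energy φ +
      β / 2 * ∑ k, S.α k * (Real.log (φ k) - Real.log (S.α k)) := rfl
  rw [e1]
  rw [e2] at h1
  linarith

variable {𝕜 : Type*} [RCLike 𝕜]

/-- The coefficients `σ²` are non-negative, so on each cell the energy is at most its value at the
upper corner `gridPoint M j`. The cells may overlap, which only weakens the upper bound. -/
lemma lintegral_energy_le {N M : ℕ} (hN : 0 < N) (hM : 0 < M) (hp : ∀ k, 0 < S.blockFreq N k)
    (θ : ℝ) :
    ∫⁻ e : USphere 𝕜 N, ENNReal.ofReal (Real.exp (N * θ ^ 2 / dysonIndex 𝕜 *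
      S.energy (S.blockMass e))) ∂(uniformSphere 𝕜 N) ≤
    ∑ j ∈ simplexGrid (Fin n) M,
      ENNReal.ofReal (Real.exp (N * S.blockGain (dysonIndex 𝕜) θ N (gridPoint M j))) := by
  have := isProbabilityMeasure_uniformSphere (𝕜 := 𝕜) hN
  have hβ := dysonIndex_pos (𝕜 := 𝕜)
  set A : (Fin n → Fin (M + 1)) → Set (USphere 𝕜 N) := fun j =>
    {e | ∀ k, S.blockMass e k ≤ gridPoint M j k} with hAdef
  have hA : ∀ j, MeasurableSet (A j) := fun j => by
    rw [hAdef]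
    dsimp only
    rw [Set.ofPred_forall]
    exact MeasurableSet.iInter fun k =>
      (isClosed_le (S.continuous_blockMass k) continuous_const).measurableSet
  set c : (Fin n → Fin (M + 1)) → ENNReal := fun j => ENNReal.ofReal (Real.exp
    (N * θ ^ 2 / dysonIndex 𝕜 * S.energy (gridPoint M j))) with hc
  have hpt : ∀ e : USphere 𝕜 N, ENNReal.ofReal (Real.exp (N * θ ^ 2 / dysonIndex 𝕜 *
      S.energy (S.blockMass e))) ≤
      ∑ j ∈ simplexGrid (Fin n) M, (A j).indicator (fun _ => c j) e := by
    intro e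
    obtain ⟨j, hj, h⟩ := exists_simplexGrid hM (S.blockMass_nonneg e) (S.sum_blockMass e).le
    refine le_trans ?_ (Finset.single_le_sum
      (f := fun j => (A j).indicator (fun _ => c j) e) (fun _ _ => zero_le) hj)
    rw [Set.indicator_of_mem (show e ∈ A j from h)]
    refine ENNReal.ofReal_le_ofReal (Real.exp_le_exp.2 (mul_le_mul_of_nonneg_left
      (S.energy_mono (S.blockMass_nonneg e) h) (by positivity)))
  refine (lintegral_mono hpt).trans ?_
  rw [lintegral_finsetSum _ fun j _ => measurable_const.indicator (hA j)]
  refine Finset.sum_le_sum fun j _ => ?_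
  rw [lintegral_indicator (hA j), setLIntegral_const,
    ← ENNReal.ofReal_toReal (measure_ne_top (uniformSphere 𝕜 N) (A j)), hc]
  dsimp only
  rw [← ENNReal.ofReal_mul (Real.exp_pos _).le]
  refine ENNReal.ofReal_le_ofReal ?_
  have h1 := S.uniformSphere_blockMass_le (𝕜 := 𝕜) hN (gridPoint_pos hM j)
  have h2 := S.volRatio_le 𝕜 hN hp
  rw [S.prod_rpow_blockCard hN _ (gridPoint_pos hM j)] at h1
  have h3 := h1.trans (mul_le_mul_of_nonneg_right h2 (Real.exp_pos _).le)
  refine (mul_le_mul_of_nonneg_left h3 (Real.exp_pos _).le).trans_eq ?_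
  rw [← Real.exp_add, ← Real.exp_add, blockGain]
  congr 1
  simp_rw [mul_sub, Finset.sum_sub_distrib]
  ring

lemma eventually_lintegral_energy_le {θ g : ℝ}
    (hg : ∀ φ ∈ stdSimplex ℝ (Fin n), (∀ k, 0 < φ k) → S.gain (dysonIndex 𝕜) θ φ ≤ g)
    {η : ℝ} (hη : 0 < η) :
    ∀ᶠ N : ℕ in atTop, ∫⁻ e : USphere 𝕜 N, ENNReal.ofReal (Real.exp (N * θ ^ 2 / dysonIndex 𝕜 *
      S.energy (S.blockMass e))) ∂(uniformSphere 𝕜 N) ≤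
      ENNReal.ofReal (Real.exp (N * (g + η))) := by
  have hβ := dysonIndex_pos (𝕜 := 𝕜)
  set β := dysonIndex 𝕜
  set C := θ ^ 2 / β * S.energy fun _ => 1
  -- The mesh is fixed before `N` grows. One third of `η` pays for the grid points off the simplex,
  -- one for replacing `blockFreq` by `α`, and one for the number of cells.
  obtain ⟨M, hM, hMη⟩ : ∃ M : ℕ, 0 < M ∧
      ((1 + (n : ℝ) / M) ^ 2 - 1) * C + β / 2 * ((n : ℝ) / M) < η / 3 := by
    have h1 : Tendsto (fun M : ℕ => (n : ℝ) / M) atTop (𝓝 0) :=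
      tendsto_const_div_atTop_nhds_zero_nat _
    have h2 : Tendsto (fun M : ℕ => ((1 + (n : ℝ) / M) ^ 2 - 1) * C + β / 2 * ((n : ℝ) / M)) atTop
        (𝓝 (((1 + 0) ^ 2 - 1) * C + β / 2 * 0)) :=
      ((((tendsto_const_nhds.add h1).pow 2).sub_const 1).mul_const C).add (h1.const_mul _)
    have h3 := h2.eventually (gt_mem_nhds (show ((1 + 0) ^ 2 - 1) * C + β / 2 * 0 < η / 3 by
      norm_num; linarith))
    obtain ⟨M, h, h'⟩ := ((eventually_gt_atTop 0).and h3).exists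
    exact ⟨M, h, h'⟩
  have hgrid : ∀ᶠ N : ℕ in atTop, ∀ j ∈ simplexGrid (Fin n) M,
      S.blockGain β θ N (gridPoint M j) < g + 2 * η / 3 := by
    rw [eventually_all_finset]
    intro j hj
    refine (S.tendsto_blockGain β θ (gridPoint M j)).eventually (gt_mem_nhds ?_)
    have := S.gain_le_of_sum_le hβ hg (by positivity) (gridPoint_pos hM j) (sum_gridPoint_le hM hj)
    linarith
  have hcard : ∀ᶠ N : ℕ in atTop, ((simplexGrid (Fin n) M).card : ℝ) ≤ Real.exp (N * (η / 3)) :=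
    (Real.tendsto_exp_atTop.comp (tendsto_natCast_atTop_atTop.atTop_mul_const
      (by linarith : 0 < η / 3))).eventually_ge_atTop _
  filter_upwards [hgrid, hcard, S.eventually_blockFreq_pos, eventually_gt_atTop 0]
    with N h1 h2 h3 h0
  refine (S.lintegral_energy_le h0 hM h3 θ).trans ?_
  refine (Finset.sum_le_card_nsmul _ _ (ENNReal.ofReal (Real.exp (N * (g + 2 * η / 3))))
    fun j hj => ENNReal.ofReal_le_ofReal (Real.exp_le_exp.2 ?_)).trans ?_
  · exact mul_le_mul_of_nonneg_left (h1 j hj).le (Nat.cast_nonneg _)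
  · rw [nsmul_eq_mul, ← ENNReal.ofReal_natCast, ← ENNReal.ofReal_mul (Nat.cast_nonneg _)]
    refine ENNReal.ofReal_le_ofReal
      ((mul_le_mul_of_nonneg_right h2 (Real.exp_pos _).le).trans_eq ?_)
    rw [← Real.exp_add]
    congr 1
    ring

end PiecewiseProfile

/-! ### The lower bound on the measure of delocalized vectors with prescribed block masses. -/

/-- A polynomial is beaten by a stretched exponential. -/
lemma tendsto_natCast_sq_mul_exp {c γ : ℝ} (hc : 0 < c) (hγ : 0 < γ) :
    Tendsto (fun N : ℕ => (N : ℝ) ^ 2 * Real.exp (-(c * (N : ℝ) ^ γ))) atTop (𝓝 0) := by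
  have h1 := tendsto_rpow_mul_exp_neg_mul_atTop_nhds_zero (2 / γ) c hc
  have h2 := h1.comp ((tendsto_rpow_atTop hγ).comp tendsto_natCast_atTop_atTop)
  refine h2.congr fun N => ?_
  simp only [Function.comp]
  rw [← Real.rpow_mul (Nat.cast_nonneg _), mul_div_cancel₀ _ hγ.ne', Real.rpow_ofNat, neg_mul]

lemma rpow_neg_sq (N : ℕ) (ε : ℝ) :
    ((N : ℝ) ^ (-(1 / 4 : ℝ) - ε)) ^ 2 = (N : ℝ) ^ (-(1 / 2 : ℝ) - 2 * ε) := by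
  rw [← Real.rpow_natCast, ← Real.rpow_mul (Nat.cast_nonneg _)]
  congr 1
  push_cast; ring

namespace PiecewiseProfile

variable {n : ℕ} (S : PiecewiseProfile n) {𝕜 : Type*} [RCLike 𝕜]

lemma tendsto_blockCard (k : Fin n) :
    Tendsto (fun N => (S.blockCard N k : ℝ)) atTop atTop := by
  have h := (tendsto_natCast_atTop_atTop (R := ℝ)).atTop_mul_pos (S.α_pos k) (S.tendsto_blockFreq k)
  refine h.congr' ?_
  filter_upwards [eventually_gt_atTop 0] with N hN
  exact S.blockFreq_mul hN k

/-- With `s` of order `N^(-1/2-2ε)`, the large-coordinate bound is `exp (-c N^(1/2-2ε))`, whose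
exponent tends to infinity because `ε < 1/4`; this beats the polynomial cost of a union over the
coordinates. That part and the inner ball each lose at most a quarter of the volume. -/
lemma eventually_flatShell {δ ε : ℝ} (hδ : 0 < δ) (hδ1 : δ < 1) (hε : 0 < ε) (hε1 : ε < 1 / 4)
    (k : Fin n) :
    ∀ᶠ N : ℕ in atTop, ballVol 𝕜 {i // S.blockIdx N i = k} / 2 ≤
      (haarPi 𝕜 {i // S.blockIdx N i = k}).real
        (flatShell 𝕜 _ δ ((1 - δ) * (N : ℝ) ^ (-(1 / 2 : ℝ) - 2 * ε)) 1) := by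
  have hβ := dysonIndex_pos (𝕜 := 𝕜)
  have hβ1 : 1 ≤ dysonIndex 𝕜 ∧ dysonIndex 𝕜 ≤ 2 := by
    rcases dysonIndex_cases (𝕜 := 𝕜) with ⟨-, h⟩ | h <;> rw [h] <;> norm_num
  have hα := S.α_pos k
  have h1δ : 0 < 1 - δ := by linarith
  set γ : ℝ := 1 / 2 - 2 * ε with hγ
  have hγ0 : 0 < γ := by rw [hγ]; linarith
  have e1 : ∀ᶠ N : ℕ in atTop,
      (1 - δ) ^ (dysonIndex 𝕜 * (S.blockCard N k : ℝ) / 2) < 1 / 4 := by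
    have h1 : Tendsto (fun N : ℕ => dysonIndex 𝕜 * (S.blockCard N k : ℝ) / 2) atTop atTop :=
      ((S.tendsto_blockCard k).const_mul_atTop hβ).atTop_div_const two_pos
    exact ((tendsto_rpow_atTop_of_base_lt_one (1 - δ) (by linarith) (by linarith)).comp
      h1).eventually (gt_mem_nhds (by norm_num))
  -- The 16 collects the 4 in the large-coordinate bound, `m - 1 ≥ m / 2`, and `m ≥ α N / 2`.
  have hc : 0 < (1 - δ) * S.α k / 16 := by positivity
  have e2 : ∀ᶠ N : ℕ in atTop, 2 / (1 - δ) *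
      ((N : ℝ) ^ 2 * Real.exp (-((1 - δ) * S.α k / 16 * (N : ℝ) ^ γ))) < 1 / 4 :=
    ((tendsto_natCast_sq_mul_exp hc hγ0).const_mul (2 / (1 - δ))).eventually
      (gt_mem_nhds (by norm_num))
  have e3 : ∀ᶠ N : ℕ in atTop, S.α k / 2 < S.blockFreq N k :=
    (S.tendsto_blockFreq k).eventually (lt_mem_nhds (by linarith))
  have e4 : ∀ᶠ N : ℕ in atTop, (2 : ℝ) ≤ S.blockCard N k :=
    (S.tendsto_blockCard k).eventually_ge_atTop 2
  filter_upwards [e1, e2, e3, e4, eventually_gt_atTop 1] with N h1 h2 h3 h4 hN1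
  have hN : 0 < N := by omega
  have hN' : (0 : ℝ) < N := by exact_mod_cast hN
  have hN1' : (1 : ℝ) < N := by exact_mod_cast hN1
  set s : ℝ := (1 - δ) * (N : ℝ) ^ (-(1 / 2 : ℝ) - 2 * ε) with hs
  set m : ℝ := ((S.blockCard N k : ℕ) : ℝ) with hm
  have hs0 : 0 < s := by positivity
  have hs1 : s < 1 := by
    have : (N : ℝ) ^ (-(1 / 2 : ℝ) - 2 * ε) < 1 :=
      Real.rpow_lt_one_of_one_lt_of_neg hN1' (by linarith)
    rw [hs]
    nlinarith [Real.rpow_pos_of_pos hN' (-(1 / 2 : ℝ) - 2 * ε)]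
  have hmN : m ≤ N := by
    have : S.blockCard N k ≤ N := by
      conv_rhs => rw [← S.sum_blockCard N]
      exact Finset.single_le_sum (fun _ _ => Nat.zero_le _) (Finset.mem_univ k)
    rw [hm]; exact_mod_cast this
  have hmα : S.α k / 2 * N ≤ m := by
    rw [hm, ← S.blockFreq_mul hN k, mul_comm]
    exact mul_le_mul_of_nonneg_left h3.le hN'.le
  have hsN : s * N = (1 - δ) * (N : ℝ) ^ γ := by
    rw [hs, mul_assoc]
    congr 1
    nth_rewrite 2 [← Real.rpow_one (N : ℝ)]
    rw [← Real.rpow_add hN']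
    congr 1; rw [hγ]; ring
  have hexp : Real.exp (-(dysonIndex 𝕜 * s * (m - 1) / 4)) ≤
      Real.exp (-((1 - δ) * S.α k / 16 * (N : ℝ) ^ γ)) := by
    rw [Real.exp_le_exp, neg_le_neg_iff]
    have h5 : m / 2 ≤ m - 1 := by linarith
    calc (1 - δ) * S.α k / 16 * (N : ℝ) ^ γ = 1 * s * (S.α k / 2 * N / 2) / 4 := by
          linear_combination (-(S.α k / 16)) * hsN
      _ ≤ dysonIndex 𝕜 * s * (m - 1) / 4 := by
          have h6 : S.α k / 2 * N / 2 ≤ m - 1 := by linarith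
          have h7 : 0 ≤ S.α k / 2 * N / 2 := by positivity
          have h8 : 1 * s ≤ dysonIndex 𝕜 * s := mul_le_mul_of_nonneg_right hβ1.1 hs0.le
          have h9 := mul_le_mul h8 h6 h7 (by positivity)
          linarith
  have hpow : (2 / s) ^ (dysonIndex 𝕜 / 2) ≤ 2 / (1 - δ) * N := by
    have h5 : 1 ≤ 2 / s := by rw [le_div_iff₀ hs0]; linarith
    calc (2 / s) ^ (dysonIndex 𝕜 / 2) ≤ (2 / s) ^ (1 : ℝ) :=
          Real.rpow_le_rpow_of_exponent_le h5 (by linarith)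
      _ = 2 / s := Real.rpow_one _
      _ ≤ 2 / (1 - δ) * N := by
          rw [div_mul_eq_mul_div, div_le_div_iff₀ hs0 h1δ]
          have h6 : 1 ≤ (N : ℝ) ^ γ := Real.one_le_rpow hN1'.le hγ0.le
          have h7 : 2 * N * s = 2 * ((1 - δ) * (N : ℝ) ^ γ) := by rw [← hsN]; ring
          rw [h7]
          nlinarith
  have hmain := flatShell_one_volume (𝕜 := 𝕜) (ι := {i // S.blockIdx N i = k}) hδ1 hs0 hs1
  refine le_trans ?_ hmain
  have hcard : (Fintype.card {i // S.blockIdx N i = k} : ℝ) = m := rfl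
  rw [hcard, div_eq_inv_mul]
  refine mul_le_mul_of_nonneg_right ?_ ballVol_pos.le
  have hbound : m * (Real.exp (-(dysonIndex 𝕜 * s * (m - 1) / 4)) *
      (2 / s) ^ (dysonIndex 𝕜 / 2)) ≤ 1 / 4 := by
    calc m * (Real.exp (-(dysonIndex 𝕜 * s * (m - 1) / 4)) * (2 / s) ^ (dysonIndex 𝕜 / 2))
        ≤ N * (Real.exp (-((1 - δ) * S.α k / 16 * (N : ℝ) ^ γ)) * (2 / (1 - δ) * N)) := by
          gcongr
      _ = 2 / (1 - δ) * ((N : ℝ) ^ 2 * Real.exp (-((1 - δ) * S.α k / 16 * (N : ℝ) ^ γ))) := by ring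
      _ ≤ 1 / 4 := h2.le
  norm_num at h1 hbound ⊢
  linarith

lemma measurableSet_deloc (ε : ℝ) (N : ℕ) : MeasurableSet (deloc (𝕜 := 𝕜) S ε N) := by
  refine IsClosed.measurableSet ?_
  unfold deloc
  simp only [Set.ofPred_forall]
  refine isClosed_iInter fun k => isClosed_iInter fun i => isClosed_iInter fun _ =>
    isClosed_le (by fun_prop) ?_
  refine Continuous.mul (Real.continuous_sqrt.comp ?_) continuous_const
  fun_prop

/-- A lower bound on the measure of the delocalized vectors with given masses of the blocks. -/
lemma le_uniformSphere_deloc {N M : ℕ} (hN : 0 < N) (hM : 0 < M) (hp : ∀ k, 0 < S.blockFreq N k)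
    {δ ε : ℝ} (hδ : 0 < δ) (hδ1 : δ < 1) {t : Fin n → ℝ} (ht : ∀ k, 0 < t k) (hsum : ∑ k, t k < 1)
    (hflat : ∀ k, ballVol 𝕜 {i // S.blockIdx N i = k} / 2 ≤
      (haarPi 𝕜 {i // S.blockIdx N i = k}).real
        (flatShell 𝕜 _ δ ((1 - δ) * (N : ℝ) ^ (-(1 / 2 : ℝ) - 2 * ε)) 1)) :
    Real.exp (N * (dysonIndex 𝕜 / 2 * (∑ k, S.blockFreq N k *
        (Real.log (t k) - Real.log (S.blockFreq N k)) - n / M))) ≤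
      2 ^ n * (simplexGrid (Fin n) M).card * (uniformSphere 𝕜 N).real
        (deloc S ε N ∩ {e | ∀ k, (1 - δ) * t k ≤ S.blockMass e k}) := by
  have h1δ : 0 < 1 - δ := by linarith
  have hN' : (0 : ℝ) < N := by exact_mod_cast hN
  have hne : Nonempty (Fin n) := ⟨⟨0, S.nat_pos⟩⟩
  -- A vector of the shell may have block mass as small as `(1 - δ) t k`. The factor `1 - δ` in `s`
  -- makes the bound `s * t k` on the coordinates at most `N^(-1/2-2ε)` times the actual mass, as
  -- `deloc` requires.
  set s : ℝ := (1 - δ) * (N : ℝ) ^ (-(1 / 2 : ℝ) - 2 * ε) with hs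
  set B : Set (Fin N → 𝕜) := {x | ∀ k, (fun i : {i // S.blockIdx N i = k} => x i) ∈
    flatShell 𝕜 {i // S.blockIdx N i = k} δ s (t k)} with hB
  have hA : MeasurableSet
      (deloc S ε N ∩ {e : USphere 𝕜 N | ∀ k, (1 - δ) * t k ≤ S.blockMass e k}) := by
    refine (S.measurableSet_deloc ε N).inter ?_
    rw [Set.ofPred_forall]
    exact MeasurableSet.iInter fun k =>
      (isClosed_le continuous_const (S.continuous_blockMass k)).measurableSet
  have hvol : (haarPi 𝕜 (Fin N)).real B / ballVol 𝕜 (Fin N) ≤ (uniformSphere 𝕜 N).real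
      (deloc S ε N ∩ {e | ∀ k, (1 - δ) * t k ≤ S.blockMass e k}) := by
    refine le_uniformSphere hN hA ?_ ?_ ?_
    · intro x hx
      rw [sqSum_eq_sum_fiber (S.blockIdx N)]
      exact Finset.sum_pos (fun k _ => (mul_pos h1δ (ht k)).trans_le (hx k).1)
        Finset.univ_nonempty
    · intro x hx
      rw [sqSum_eq_sum_fiber (S.blockIdx N)]
      exact (Finset.sum_le_sum fun k _ => (hx k).2.1).trans_lt hsum
    · intro e r h0 h1 hx
      have hr2 : r ^ 2 ≤ 1 := by nlinarith
      have hr0 : 0 < r ^ 2 := by positivity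
      have hmass : ∀ k, (1 - δ) * t k ≤ r ^ 2 * S.blockMass e k := fun k => by
        have := (hx k).1
        have h2 := sqSum_smul r fun i : {i // S.blockIdx N i = k} => e.1.ofLp i
        exact this.trans_eq h2
      refine ⟨fun k i hi => ?_, fun k => (hmass k).trans
        (mul_le_of_le_one_left (S.blockMass_nonneg e k) hr2)⟩
      rw [← S.blockMass_eq]
      have hik := (S.mem_block_iff i k).1 hi
      have h3 : ‖(r • e.1.ofLp) i‖ ^ 2 ≤ s * t k := (hx k).2.2 ⟨i, hik⟩
      rw [Pi.smul_apply, norm_smul, mul_pow, Real.norm_eq_abs, sq_abs] at h3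
      have h4 : r ^ 2 * ‖e.1 i‖ ^ 2 ≤
          r ^ 2 * (S.blockMass e k * (N : ℝ) ^ (-(1 / 2 : ℝ) - 2 * ε)) := by
        refine h3.trans ?_
        have h5 : 0 ≤ (N : ℝ) ^ (-(1 / 2 : ℝ) - 2 * ε) := by positivity
        have := mul_le_mul_of_nonneg_right (hmass k) h5
        rw [hs]
        linarith
      have h6 := le_of_mul_le_mul_left h4 hr0
      refine le_of_sq_le_sq ?_ (by positivity)
      rw [mul_pow, Real.sq_sqrt (S.blockMass_nonneg e k), rpow_neg_sq]
      exact h6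
  -- Each shell has at least half the volume of its ball, and the loss `2 ^ n` does not depend on
  -- `N`.
  have hBvol : (∏ k, t k ^ (dysonIndex 𝕜 * S.blockCard N k / 2)) *
      ((∏ k, ballVol 𝕜 {i // S.blockIdx N i = k}) / 2 ^ n) ≤ (haarPi 𝕜 (Fin N)).real B := by
    rw [hB, haarPi_real_blocks (S.blockIdx N) fun k =>
      flatShell 𝕜 {i // S.blockIdx N i = k} δ s (t k)]
    have h2 : ((2 : ℝ) ^ n) = ∏ _k : Fin n, (2 : ℝ) := by simp
    rw [h2, ← Finset.prod_div_distrib, ← Finset.prod_mul_distrib]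
    refine Finset.prod_le_prod (fun k _ => ?_) fun k _ => ?_
    · exact mul_nonneg (Real.rpow_nonneg (ht k).le _) (div_nonneg ballVol_pos.le two_pos.le)
    · rw [flatShell_volume (ht k)]
      exact mul_le_mul_of_nonneg_left (hflat k) (Real.rpow_nonneg (ht k).le _)
  have hR : (∏ k, t k ^ (dysonIndex 𝕜 * S.blockCard N k / 2)) * S.volRatio 𝕜 N ≤
      2 ^ n * (uniformSphere 𝕜 N).real
        (deloc S ε N ∩ {e | ∀ k, (1 - δ) * t k ≤ S.blockMass e k}) := by
    have h1 := (div_le_div_of_nonneg_right hBvol (ballVol_pos (𝕜 := 𝕜) (ι := Fin N)).le).trans hvol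
    have h2 := mul_le_mul_of_nonneg_left h1 (by positivity : (0 : ℝ) ≤ 2 ^ n)
    refine le_trans (le_of_eq ?_) h2
    rw [volRatio]
    field_simp
  have hlow := S.le_volRatio 𝕜 hN hM hp
  rw [S.prod_rpow_blockCard hN _ ht] at hR
  set E := Real.exp (N * (dysonIndex 𝕜 / 2 * ∑ k, S.blockFreq N k * Real.log (t k)))
  have hE : 0 ≤ E := (Real.exp_pos _).le
  calc Real.exp (N * (dysonIndex 𝕜 / 2 * (∑ k, S.blockFreq N k *
        (Real.log (t k) - Real.log (S.blockFreq N k)) - n / M)))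
      = E * Real.exp (-(N * (dysonIndex 𝕜 / 2 *
        (∑ k, S.blockFreq N k * Real.log (S.blockFreq N k) + n / M)))) := by
        rw [← Real.exp_add]
        congr 1
        simp_rw [mul_sub, Finset.sum_sub_distrib]
        ring
    _ ≤ E * ((simplexGrid (Fin n) M).card * S.volRatio 𝕜 N) := mul_le_mul_of_nonneg_left hlow hE
    _ = (simplexGrid (Fin n) M).card * (E * S.volRatio 𝕜 N) := by ring
    _ ≤ (simplexGrid (Fin n) M).card * (2 ^ n * (uniformSphere 𝕜 N).real
        (deloc S ε N ∩ {e | ∀ k, (1 - δ) * t k ≤ S.blockMass e k})) :=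
        mul_le_mul_of_nonneg_left hR (Nat.cast_nonneg _)
    _ = _ := by ring

end PiecewiseProfile

/-! ### Annealed bounds: combining the Laplace estimates with the block masses. -/

namespace PiecewiseProfile

variable {n : ℕ} (S : PiecewiseProfile n) {𝕜 : Type*} [RCLike 𝕜]

lemma abs_profileMatrix_le {N : ℕ} (i j : Fin N) :
    |S.profileMatrix N i j| ≤ ∑ k, ∑ l, S.σ k l := by
  rw [S.profileMatrix_eq, abs_of_nonneg (S.σ_nonneg _ _)]
  refine (Finset.single_le_sum (fun l _ => S.σ_nonneg (S.blockIdx N i) l)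
    (Finset.mem_univ (S.blockIdx N j))).trans ?_
  exact Finset.single_le_sum (f := fun k => ∑ l, S.σ k l)
    (fun k _ => Finset.sum_nonneg fun l _ => S.σ_nonneg k l) (Finset.mem_univ (S.blockIdx N i))

lemma norm_le_of_mem_deloc {N : ℕ} {ε : ℝ} {e : USphere 𝕜 N} (he : e ∈ deloc S ε N) (i : Fin N) :
    ‖e.1 i‖ ≤ (N : ℝ) ^ (-(1 / 4 : ℝ) - ε) := by
  have h := he (S.blockIdx N i) i ((S.mem_block_iff i _).2 rfl)
  rw [← S.blockMass_eq] at h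
  refine h.trans (mul_le_of_le_one_left (by positivity) ?_)
  exact Real.sqrt_le_one.2 (S.blockMass_le_one e _)

/-- The coefficients of the entries in the exponent are small for delocalized vectors. -/
lemma eventually_deloc_coeff_le (θ : ℝ) (hθ : 0 ≤ θ) {ε δ : ℝ} (hε : 0 < ε) (hδ : 0 < δ) :
    ∀ᶠ N : ℕ in atTop, ∀ e ∈ deloc (𝕜 := 𝕜) S ε N, ∀ i j,
      2 * (θ * √N * |S.profileMatrix N i j|) * (‖e.1 i‖ * ‖e.1 j‖) ≤ δ / 72 := by
  set s := ∑ k, ∑ l, S.σ k l with hs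
  have hs0 : 0 ≤ s := Finset.sum_nonneg fun k _ => Finset.sum_nonneg fun l _ => S.σ_nonneg k l
  have hlim : Tendsto (fun N : ℕ => 2 * θ * s * (N : ℝ) ^ (-(2 * ε))) atTop
      (𝓝 (2 * θ * s * 0)) :=
    ((tendsto_rpow_neg_atTop (by linarith : 0 < 2 * ε)).comp
      tendsto_natCast_atTop_atTop).const_mul _
  rw [mul_zero] at hlim
  filter_upwards [hlim.eventually (gt_mem_nhds (by linarith : (0 : ℝ) < δ / 72)),
    eventually_gt_atTop 0] with N hN h0 e he i j
  have hN' : (0 : ℝ) < N := by exact_mod_cast h0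
  refine le_trans ?_ hN.le
  have h1 : ‖e.1 i‖ * ‖e.1 j‖ ≤ (N : ℝ) ^ (-(1 / 2 : ℝ) - 2 * ε) := by
    rw [← rpow_neg_sq, sq]
    exact mul_le_mul (S.norm_le_of_mem_deloc he i) (S.norm_le_of_mem_deloc he j) (norm_nonneg _)
      (by positivity)
  have h2 : √(N : ℝ) * (N : ℝ) ^ (-(1 / 2 : ℝ) - 2 * ε) = (N : ℝ) ^ (-(2 * ε)) := by
    rw [Real.sqrt_eq_rpow, ← Real.rpow_add hN']
    congr 1; ring
  calc 2 * (θ * √N * |S.profileMatrix N i j|) * (‖e.1 i‖ * ‖e.1 j‖)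
      ≤ 2 * (θ * √N * s) * (N : ℝ) ^ (-(1 / 2 : ℝ) - 2 * ε) := by
        gcongr
        exact S.abs_profileMatrix_le i j
    _ = 2 * θ * s * (√N * (N : ℝ) ^ (-(1 / 2 : ℝ) - 2 * ε)) := by ring
    _ = _ := by rw [h2]

variable {Ω : ℕ → Type*} [∀ N, MeasurableSpace (Ω N)] {P : ∀ N, Measure (Ω N)}
  [∀ N, IsProbabilityMeasure (P N)] {a : ∀ N, Fin N → Fin N → Ω N → 𝕜}

lemma eventually_annealed_le (ha : ∀ N, IsWignerFamily (P N) (a N))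
    (hsub : ∀ N i j, i ≤ j → SharpSubGaussian ((P N).map (a N i j))) {θ : ℝ} (hθ : 0 ≤ θ) {g : ℝ}
    (hg : ∀ φ ∈ stdSimplex ℝ (Fin n), (∀ k, 0 < φ k) → S.gain (dysonIndex 𝕜) θ φ ≤ g)
    {η : ℝ} (hη : 0 < η) :
    ∀ᶠ N : ℕ in atTop, ∫⁻ e, ∫⁻ ω, ENNReal.ofReal (Real.exp (N * θ * quadForm
      (modelMatrix (S.profileMatrix N) fun i j => a N i j ω) e)) ∂(P N) ∂(uniformSphere 𝕜 N) ≤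
      ENNReal.ofReal (Real.exp (N * (g + η))) := by
  filter_upwards [S.eventually_lintegral_energy_le hg hη, eventually_gt_atTop 0] with N h h0
  refine (lintegral_mono fun e => ?_).trans h
  rw [← S.sum_profileMatrix_eq e]
  exact lintegral_exponent_le h0 (ha N) (hsub N) (S.profileMatrix_isSymm N) hθ e

/-- It suffices to integrate over the delocalized vectors whose block masses are nearly `ψ`: there
the averaged exponential is almost its sub-Gaussian bound, and their measure is known at exponential
scale. -/
lemma eventually_le_annealed_deloc (ha : ∀ N, IsWignerFamily (P N) (a N))
    (hsub : ∀ N i j, i ≤ j → SharpSubGaussian ((P N).map (a N i j))) {θ : ℝ} (hθ : 0 ≤ θ)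
    {ε : ℝ} (hε : 0 < ε) (hε1 : ε < 1 / 4) {ψ : Fin n → ℝ} (hψ : ψ ∈ stdSimplex ℝ (Fin n))
    (hpos : ∀ k, 0 < ψ k) {η : ℝ} (hη : 0 < η) :
    ∀ᶠ N : ℕ in atTop, ENNReal.ofReal (Real.exp (N * (S.gain (dysonIndex 𝕜) θ ψ - η))) ≤
      ∫⁻ e in deloc S ε N, ∫⁻ ω, ENNReal.ofReal (Real.exp (N * θ * quadForm
        (modelMatrix (S.profileMatrix N) fun i j => a N i j ω) e)) ∂(P N) ∂(uniformSphere 𝕜 N) := by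
  have hβ := dysonIndex_pos (𝕜 := 𝕜)
  set β := dysonIndex 𝕜 with hβdef
  set K := θ ^ 2 / β * S.energy ψ with hK
  set H := ∑ k, S.α k * (Real.log (ψ k) - Real.log (S.α k)) with hH
  have hgain : S.gain β θ ψ = K + β / 2 * H := rfl
  -- Of the five factors `1 - δ`, one comes from the lower bound on the Laplace transform, two from
  -- shrinking `ψ` to `t` in the quadratic energy, and two from the masses being only at least `(1 -
  -- δ) t`. Shrinking also adds `log (1 - δ)` to the entropy. The other two thirds of `η` pay for `n
  -- / M` and for the constant `2 ^ n * card`.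
  obtain ⟨δ, hδ, hδ1, hδη⟩ : ∃ δ : ℝ, 0 < δ ∧ δ < 1 ∧
      K + β / 2 * H - η / 3 < (1 - δ) ^ 5 * K + β / 2 * (H + Real.log (1 - δ)) := by
    have hc : ContinuousAt (fun δ : ℝ => (1 - δ) ^ 5 * K + β / 2 * (H + Real.log (1 - δ))) 0 := by
      have h1 : ContinuousAt (fun δ : ℝ => Real.log (1 - δ)) 0 :=
        ContinuousAt.log (by fun_prop) (by norm_num)
      exact ContinuousAt.add (by fun_prop) (continuousAt_const.mul (continuousAt_const.add h1))
    have h2 := hc.eventually (lt_mem_nhds (a := K + β / 2 * H - η / 3) (by simp; linarith))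
    have h3 : ∀ᶠ δ : ℝ in 𝓝[>] 0, 0 < δ ∧ δ < 1 := Ioo_mem_nhdsGT one_pos
    obtain ⟨δ, h, h', h''⟩ := ((h2.filter_mono nhdsWithin_le_nhds).and h3).exists
    exact ⟨δ, h', h'', h⟩
  have h1δ : 0 < 1 - δ := by linarith
  obtain ⟨M, hM, hMη⟩ : ∃ M : ℕ, 0 < M ∧ β / 2 * ((n : ℝ) / M) < η / 3 := by
    have h1 : Tendsto (fun M : ℕ => β / 2 * ((n : ℝ) / M)) atTop (𝓝 (β / 2 * 0)) :=
      (tendsto_const_div_atTop_nhds_zero_nat _).const_mul _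
    rw [mul_zero] at h1
    obtain ⟨M, h, h'⟩ := ((eventually_gt_atTop 0).and
      (h1.eventually (gt_mem_nhds (by linarith : (0 : ℝ) < η / 3)))).exists
    exact ⟨M, h, h'⟩
  -- The sum of `t` has to be strictly below one, because the cones over sets of the sphere are open
  -- at radius one.
  set t : Fin n → ℝ := fun k => (1 - δ) * ψ k with ht
  have ht0 : ∀ k, 0 < t k := fun k => mul_pos h1δ (hpos k)
  have htsum : ∑ k, t k < 1 := by
    rw [ht, ← Finset.mul_sum, hψ.2]; linarith
  set L : ℕ → ℝ := fun N => (1 - δ) * (θ ^ 2 / β * S.energy fun k => (1 - δ) * t k) +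
    β / 2 * (∑ k, S.blockFreq N k * (Real.log (t k) - Real.log (S.blockFreq N k)) - n / M) with hL
  have hLlim : ∀ᶠ N in atTop, K + β / 2 * H - 2 * η / 3 < L N := by
    have h1 : Tendsto L atTop (𝓝 ((1 - δ) * (θ ^ 2 / β * S.energy fun k => (1 - δ) * t k) +
      β / 2 * (∑ k, S.α k * (Real.log (t k) - Real.log (S.α k)) - n / M))) :=
      tendsto_const_nhds.add (((S.tendsto_entropy t).sub_const _).const_mul _)
    refine h1.eventually (lt_mem_nhds ?_)
    have h2 : ∑ k, S.α k * (Real.log (t k) - Real.log (S.α k)) = H + Real.log (1 - δ) := by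
      have : Real.log (1 - δ) = ∑ k, S.α k * Real.log (1 - δ) := by
        rw [← Finset.sum_mul, S.α_sum, one_mul]
      rw [this, hH, ← Finset.sum_add_distrib]
      refine Finset.sum_congr rfl fun k _ => ?_
      rw [ht]
      dsimp only
      rw [Real.log_mul h1δ.ne' (hpos k).ne']
      ring
    have h3 : (1 - δ) * (θ ^ 2 / β * S.energy fun k => (1 - δ) * t k) = (1 - δ) ^ 5 * K := by
      rw [S.energy_smul, ht, S.energy_smul, hK]
      ring
    rw [h2, h3]
    linarith
  have hcard : ∀ᶠ N : ℕ in atTop,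
      (2 ^ n * (simplexGrid (Fin n) M).card : ℝ) ≤ Real.exp (N * (η / 3)) :=
    (Real.tendsto_exp_atTop.comp (tendsto_natCast_atTop_atTop.atTop_mul_const
      (by linarith : 0 < η / 3))).eventually_ge_atTop _
  filter_upwards [hLlim, hcard, S.eventually_blockFreq_pos, eventually_gt_atTop 0,
    S.eventually_deloc_coeff_le (𝕜 := 𝕜) θ hθ hε hδ,
    eventually_all.2 (S.eventually_flatShell (𝕜 := 𝕜) hδ hδ1 hε hε1)]
    with N h1 h2 h3 h0 h4 h5
  have := isProbabilityMeasure_uniformSphere (𝕜 := 𝕜) h0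
  set G : Set (USphere 𝕜 N) := deloc S ε N ∩ {e | ∀ k, (1 - δ) * t k ≤ S.blockMass e k} with hG
  set c := (1 - δ) * (N * θ ^ 2 / β * S.energy fun k => (1 - δ) * t k) with hc
  have hvol := S.le_uniformSphere_deloc (𝕜 := 𝕜) h0 hM h3 hδ hδ1 ht0 htsum h5
  rw [← hG, ← hβdef] at hvol
  have hlow : ENNReal.ofReal (Real.exp c) * uniformSphere 𝕜 N G ≤
      ∫⁻ e in deloc S ε N, ∫⁻ ω, ENNReal.ofReal (Real.exp (N * θ * quadForm
        (modelMatrix (S.profileMatrix N) fun i j => a N i j ω) e)) ∂(P N) ∂(uniformSphere 𝕜 N) := by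
    have hGm : MeasurableSet G := by
      refine (S.measurableSet_deloc ε N).inter ?_
      rw [Set.ofPred_forall]
      exact MeasurableSet.iInter fun k =>
        (isClosed_le continuous_const (S.continuous_blockMass k)).measurableSet
    rw [← setLIntegral_const]
    refine (setLIntegral_mono' hGm fun e he => ?_).trans
      (lintegral_mono_set (Set.inter_subset_left : G ⊆ deloc S ε N))
    refine le_trans ?_ (le_lintegral_exponent h0 (ha N) (hsub N) (S.profileMatrix_isSymm N) hθ e
      hδ hδ1.le (h4 e he.1))
    rw [S.sum_profileMatrix_eq e]
    refine ENNReal.ofReal_le_ofReal (Real.exp_le_exp.2 ?_)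
    refine mul_le_mul_of_nonneg_left (mul_le_mul_of_nonneg_left ?_ (by positivity)) h1δ.le
    exact S.energy_mono (fun k => (mul_pos h1δ (ht0 k)).le) he.2
  refine le_trans ?_ hlow
  rw [← ENNReal.ofReal_toReal (measure_ne_top (uniformSphere 𝕜 N) G),
    ← ENNReal.ofReal_mul (Real.exp_pos _).le]
  refine ENNReal.ofReal_le_ofReal ?_
  change _ ≤ Real.exp c * (uniformSphere 𝕜 N).real G
  have hN0 : (0 : ℝ) ≤ N := Nat.cast_nonneg _
  have h6 : Real.exp (N * L N) ≤
      Real.exp (N * (η / 3)) * (Real.exp c * (uniformSphere 𝕜 N).real G) := by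
    calc Real.exp (N * L N) = Real.exp c * Real.exp (N * (β / 2 * (∑ k, S.blockFreq N k *
          (Real.log (t k) - Real.log (S.blockFreq N k)) - n / M))) := by
          rw [← Real.exp_add, hL, hc]
          congr 1
          ring
      _ ≤ Real.exp c * (2 ^ n * (simplexGrid (Fin n) M).card * (uniformSphere 𝕜 N).real G) :=
          mul_le_mul_of_nonneg_left hvol (Real.exp_pos _).le
      _ ≤ Real.exp c * (Real.exp (N * (η / 3)) * (uniformSphere 𝕜 N).real G) := by
          gcongr
      _ = _ := by ring
  have h7 : Real.exp (N * (η / 3)) * Real.exp (N * (S.gain β θ ψ - η)) ≤ Real.exp (N * L N) := by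
    rw [← Real.exp_add, hgain, ← mul_add]
    refine Real.exp_le_exp.2 (mul_le_mul_of_nonneg_left ?_ hN0)
    linarith
  exact le_of_mul_le_mul_left (h7.trans h6) (Real.exp_pos _)

end PiecewiseProfile

end VarianceProfile

/-! ### The theorem. -/

theorem mainTheorem5 {𝕜 : Type*} [RCLike 𝕜] {n : ℕ} (S : VarianceProfile.PiecewiseProfile n)
    {Ω : ℕ → Type*} [∀ N, MeasurableSpace (Ω N)] (P : ∀ N, Measure (Ω N))
    [∀ N, IsProbabilityMeasure (P N)] (a : ∀ N, Fin N → Fin N → Ω N → 𝕜)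
    (ha : ∀ N, VarianceProfile.IsWignerFamily (P N) (a N))
    (hsub : ∀ N i j, i ≤ j → VarianceProfile.SharpSubGaussian ((P N).map (a N i j)))
    (θ : ℝ) (hθ : 0 ≤ θ) :
    IsGreatest (S.vecPsi (VarianceProfile.dysonIndex 𝕜) θ '' stdSimplex ℝ (Fin n))
        (VarianceProfile.limitF (VarianceProfile.dysonIndex 𝕜) θ S.profile) ∧
      Tendsto (fun N => VarianceProfile.annealedF S (P N) (a N) θ) atTop
        (𝓝 (VarianceProfile.limitF (VarianceProfile.dysonIndex 𝕜) θ S.profile)) ∧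
      ∀ ε : ℝ, 0 < ε → ε < 1 / 4 →
        Tendsto (fun N => VarianceProfile.annealedFDeloc S (P N) (a N) θ ε) atTop
          (𝓝 (VarianceProfile.limitF (VarianceProfile.dysonIndex 𝕜) θ S.profile)) := by
  have hβ := VarianceProfile.dysonIndex_pos (𝕜 := 𝕜)
  refine ⟨S.isGreatest_limitF hβ θ, ?_⟩
  obtain ⟨ψ, hψ, hpos, hmax⟩ := S.exists_gain_max hβ θ
  rw [S.limitF_eq hβ hψ hpos hmax]
  refine ⟨?_, fun ε hε hε1 => ?_⟩
  · unfold VarianceProfile.annealedF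
    refine VarianceProfile.tendsto_inv_mul_log (fun η hη => ?_) fun η hη => ?_
    -- The integrand is non-negative, so the delocalized lower bound for any single `ε` in `(0,
    -- 1/4)` bounds the full integral.
    · filter_upwards [S.eventually_le_annealed_deloc ha hsub hθ (ε := 1 / 8) (by norm_num)
        (by norm_num) hψ hpos hη, eventually_gt_atTop 0] with N h h0
      rw [VarianceProfile.lintegral_swap_exponent h0 (ha N)]
      exact h.trans (setLIntegral_le_lintegral _ _)
    · filter_upwards [S.eventually_annealed_le ha hsub hθ hmax hη, eventually_gt_atTop 0]
        with N h h0
      rw [VarianceProfile.lintegral_swap_exponent h0 (ha N)]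
      exact h
  · unfold VarianceProfile.annealedFDeloc
    refine VarianceProfile.tendsto_inv_mul_log
      (fun η hη => S.eventually_le_annealed_deloc ha hsub hθ hε hε1 hψ hpos hη) fun η hη => ?_
    -- Conversely, restricting to the delocalized vectors only decreases the integral, so the full
    -- upper bound applies.
    filter_upwards [S.eventually_annealed_le ha hsub hθ hmax hη] with N h
    exact (setLIntegral_le_lintegral _ _).trans h
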